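/- **Setting.** A \emph{regular network} $N$ of valency $\vartheta\ge 1$ is a finite directed graph (multiple edges and loops allowed) in which every cell $c$ is the target of exactly $\vartheta$ edges; $I(c)$ is the set of these edges. Its adjacency matrix $A$ has as entry $A_{cc'}$ the number of edges from $c'$ to $c$. A coloring is an equivalence relation on the cells; it is \emph{balanced} if for any two cells of the same color there is a bijection between their input sets preserving the colors of the source cells. For balanced $\bowtie$, the quotient network $N/\!\bowtie$ has the color classes as cells, and the edges into a class are the edges of $N$ into a representative of it, each starting at the class of its source. Write $\Delta_{\bowtie}=\{x\in\mathbb R^{|N|}: x_c=x_d \text{ whenever } c\bowtie d\}$, and $\bowtie\prec\bowtie'$ if $\bowtie$ is a strict refinement of $\bowtie'$. An eigenvalue is semisimple if its algebraic and geometric multiplicities agree. The coloring $\bowtie$ is \emph{$\mu$-maximal} if $\mu$ is not an eigenvalue of the adjacency matrix of $N/\!\bowtie'$ for any balanced $\bowtie'$ with $\bowtie\prec\bowtie'$. For $\mu\in\mathbb R$ let $\mathcal B_\mu$ be the set of functions $f:\mathbb R\times\mathbb R^\vartheta\times\mathbb R\to\mathbb R$, $(x_0,x_1,\dots,x_\vartheta,\lambda)\mapsto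 f$, that are invariant under permutations of $x_1,\dots,x_\vartheta$, smooth in a neighborhood of the origin, satisfy $f(0,0,\dots,0,\lambda)=0$ for all $\lambda$, and have a bifurcation condition associated to $\mu$: $f_0+\mu f_1=0$ and $f_1\ne0$, where $f_0=\partial f/\partial x_0$, $f_1=\partial f/\partial x_1$ at the origin. Put $(f^N(x,\lambda))_c=f(x_c,(x_{s(e)})_{e\in I(c)},\lambda)$ and $J_f^N=(D_xf^N)_{(0,0)}$. A property holds \emph{generically} (for $f\in\mathcal B_\mu$) if it holds on a relatively open and dense subset of $\mathcal B_\mu$ in the topology of convergence of all derivatives at the origin. Let $m=\dim\ker J_f^N$, let $v_1,\dots,v_m$ be a basis of $\ker J_f^N$ and $v_1^*,\dots,v_m^*$ the basis of $(\operatorname{ran}J_f^N)^\perp$ with $\langle v_i^*,v_j\rangle=\delta_{ij}$ (it exists if $\mu$ is semisimple). Let $g:\mathbb R^m\times\mathbb R\to\mathbb R^m$ be the Lyapunov--Schmidt reduction of $f^N(x,\lambda)=0$ at the origin: $g_i(y,\lambda)=\langle v_i^*,f^N(\sum_j y_jv_j+W(y,\lambda),\lambda)\rangle$, where $W$, with values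 in $(\ker J_f^N)^\perp$ and $W(0,0)=0$, is the smooth solution near the origin of the equation that the orthogonal projection of $f^N(\sum_j y_jv_j+W,\lambda)$ onto $\operatorname{ran}J_f^N$ vanishes. Let $k(N,f)$ be the smallest degree in which the Taylor expansion of $y\mapsto g(y,0)$ at $0$ has a nonvanishing homogeneous term. Let $k(N,\mu)$ be the generic value of $k(N,f)$ for $f\in\mathcal B_\mu$. With $k=k(N,\mu)$ and $a=f_{0\lambda}+\mu f_{1\lambda}$ (where $f_{i\lambda}=\partial^2f/\partial x_i\partial\lambda$ at the origin), let $Q_k$ be the homogeneous term of degree $k$ of $g(\cdot,0)$ and, for $u\in S^{m-1}$, $\eta\in\mathbb R$, $$h(u,0,\eta)=\eta a u+Q_k(u),\qquad \tilde\eta(u)=-\frac{\langle Q_k(u),u\rangle}{a},\qquad \tilde h(u)=h(u,0,\tilde\eta(u)).$$ Condition (H1) \emph{holds for $f$ and $N$} if for every $\tilde u\in S^{m-1}$ with $\tilde h(\tilde u)=0$ the derivative of $(u,\eta)\mapsto h(u,0,\eta)$ on $S^{m-1}\times\mathbb R$ at $(\tilde u,\tilde\eta(\tilde u))$ is non-singular.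 (Generically $a\neq 0$; neither $k(N,f)$ nor (H1) depends on the choice of the basis.) A \emph{bifurcation branch of $f$ on $N$} is a differentiable map $b=(b_N,b_\lambda):[0,\delta[\to\mathbb R^{|N|}\times\mathbb R$, $\delta>0$, with $b(0)=0$ and $b_\lambda(z)\ne0$, $b_N(z)\neq0$, $f^N(b(z))=0$ for all $z>0$. It has \emph{exactly synchrony} $\bowtie$ if $b_N([0,\delta[)\subseteq\Delta_{\bowtie}$ and $b_N([0,\delta[)\not\subseteq\Delta_{\bowtie'}$ for every balanced $\bowtie'$ with $\bowtie\prec\bowtie'$. **Theorem.** Let $N$ be a regular network of valency $\vartheta\geq 1$ with adjacency matrix $A$, $\bowtie$ a balanced coloring of $N$, and $\mu\in\mathbb R$ a semisimple eigenvalue of $A$. Assume that $\bowtie$ is $\mu$-maximal and that $k(N/\!\bowtie,\mu)$ exists and is even. Then generically for $f\in\mathcal B_\mu$ the following holds: if the origin is an isolated zero of $f^N(\cdot,0)$, $\dim(\ker J_f^N\cap\Delta_{\bowtie})=2$, and condition (H1) holds for $f$ and $N/\!\bowtie$, then there is a bifurcation branch of $f$ on $N$ with exactly synchrony $\bowtie$.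 -/

import Mathlib

open Set Filter Topology
open scoped ContDiff

/-- A regular network of valency `ϑ` with set of cells `C` and set of directed edges `E`:
a directed graph in which every cell is the target of exactly `ϑ` edges. -/
structure RegularNetwork (C E : Type*) (ϑ : ℕ) where
  /-- the source cell of an edge -/
  s : E → C
  /-- the target cell of an edge -/
  t : E → C
  card_input : ∀ c, Nat.card {e // t e = c} = ϑ

/-- The variables `(x₀, (x₁, …, x_ϑ), lam)` of a function defining a family of coupled cell systems. -/
abbrev CellVars (ϑ : ℕ) : Type := ℝ × (Fin ϑ → ℝ) × ℝ

noncomputable instance instFintypeColoringQuotient {C : Type*} [Finite C] (r : Setoid C) :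
    Fintype (Quotient r) := Fintype.ofFinite _

namespace RegularNetwork

variable {C E : Type*} {ϑ : ℕ}

/-- The adjacency matrix: the entry `(c, c')` is the number of edges from `c'` to `c`. -/
noncomputable def adjacency (N : RegularNetwork C E ϑ) : Matrix C C ℝ :=
  Matrix.of fun c c' => (Nat.card {e // N.s e = c' ∧ N.t e = c} : ℝ)

/-- The adjacency matrix as a linear endomorphism of `ℝ^|N|`. -/
noncomputable def adjacencyEnd [Fintype C] (N : RegularNetwork C E ϑ) : Module.End ℝ (C → ℝ) :=
  N.adjacency.mulVecLin

/-- `μ` is an eigenvalue of the adjacency matrix. -/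
def IsEigenvalue [Fintype C] (N : RegularNetwork C E ϑ) (μ : ℝ) : Prop :=
  N.adjacencyEnd.HasEigenvalue μ

/-- `μ` is a semisimple eigenvalue of the adjacency matrix: its algebraic and geometric
multiplicities agree. -/
def IsSemisimpleEigenvalue [Fintype C] (N : RegularNetwork C E ϑ) (μ : ℝ) : Prop :=
  N.IsEigenvalue μ ∧
    N.adjacencyEnd.charpoly.rootMultiplicity μ = Module.finrank ℝ (N.adjacencyEnd.eigenspace μ)

/-- A coloring is an equivalence relation `r` on the cells; it is balanced if for any two cells of
the same color there is a color-preserving bijection between their input sets. -/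
def IsBalanced (N : RegularNetwork C E ϑ) (r : Setoid C) : Prop :=
  ∀ c d, r c d → ∃ β : {e // N.t e = c} ≃ {e // N.t e = d}, ∀ e, r (N.s e.1) (N.s (β e).1)

/-- The edges of the quotient network: the edges of `N` whose target is the chosen representative
of its color. -/
abbrev QuotientEdge (N : RegularNetwork C E ϑ) (r : Setoid C) : Type _ :=
  {e : E // (Quotient.mk r (N.t e)).out = N.t e}

/-- The quotient network `N/r`. Its cells are the color classes; the edges into a class `q` are the
edges of `N` into the representative of `q`, each starting at the class of its source.
For a balanced coloring the representative does not matter (up to isomorphism). -/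
def quotient (N : RegularNetwork C E ϑ) (r : Setoid C) :
    RegularNetwork (Quotient r) (N.QuotientEdge r) ϑ where
  s e := Quotient.mk r (N.s e.1)
  t e := Quotient.mk r (N.t e.1)
  card_input q := by
    refine Eq.trans (Nat.card_congr (β := {e // N.t e = q.out})
      ⟨fun e => ⟨e.1.1, ?_⟩, fun e => ⟨⟨e.1, ?_⟩, ?_⟩, ?_, ?_⟩) (N.card_input q.out)
    · exact e.1.2.symm.trans (congrArg Quotient.out e.2)
    · rw [e.2, Quotient.out_eq]
    · change Quotient.mk r (N.t e.1) = q
      rw [e.2, Quotient.out_eq]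
    · intro e; rfl
    · intro e; rfl

/-- `r` is `μ`-maximal: `μ` is not an eigenvalue of the adjacency matrix of `N/r'` for any balanced
coloring `r'` of which `r` is a strict refinement. -/
def IsMaximalColoring [Fintype C] (N : RegularNetwork C E ϑ) (μ : ℝ) (r : Setoid C) : Prop :=
  ∀ r' : Setoid C, N.IsBalanced r' → r < r' → ¬ (N.quotient r').IsEigenvalue μ

/-- An enumeration of the input set of a cell. -/
noncomputable def inputEquiv [Finite E] (N : RegularNetwork C E ϑ) (c : C) :
    Fin ϑ ≃ {e // N.t e = c} :=
  (Finite.equivFinOfCardEq (N.card_input c)).symm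

/-- The family `f^N` of admissible vector fields defined by `f`:
`f^N(x, lam)_c = f(x_c, x_{s(I(c))}, lam)`. (For symmetric `f` the enumeration of the input set is
irrelevant.) -/
noncomputable def vectorField [Finite E] (N : RegularNetwork C E ϑ) (f : CellVars ϑ → ℝ) :
    (C → ℝ) × ℝ → C → ℝ :=
  fun p c => f (p.1 c, fun i => p.1 (N.s (N.inputEquiv c i).1), p.2)

end RegularNetwork

/-- The polydiagonal subspace of a coloring. -/
def polydiagonal {C : Type*} (r : Setoid C) : Submodule ℝ (C → ℝ) where
  carrier := {x | ∀ c d, r c d → x c = x d}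
  add_mem' hx hy c d h := by simp [hx c d h, hy c d h]
  zero_mem' _ _ _ := rfl
  smul_mem' a x hx c d h := by simp [hx c d h]

section Functions

variable {ϑ : ℕ}

/-- `f₀ = ∂f/∂x₀` at the origin. -/
noncomputable def coeff0 (f : CellVars ϑ → ℝ) : ℝ := fderiv ℝ f 0 (1, 0, 0)

/-- `f₁ = ∂f/∂x₁` at the origin. -/
noncomputable def coeff1 [NeZero ϑ] (f : CellVars ϑ → ℝ) : ℝ :=
  fderiv ℝ f 0 (0, Pi.single (0 : Fin ϑ) 1, 0)

/-- `∂²f/∂x₀∂lam` at the origin. -/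
noncomputable def coeff0Lam (f : CellVars ϑ → ℝ) : ℝ :=
  iteratedFDeriv ℝ 2 f 0 ![(1, 0, 0), (0, 0, 1)]

/-- `∂²f/∂x₁∂lam` at the origin. -/
noncomputable def coeff1Lam [NeZero ϑ] (f : CellVars ϑ → ℝ) : ℝ :=
  iteratedFDeriv ℝ 2 f 0 ![(0, Pi.single (0 : Fin ϑ) 1, 0), (0, 0, 1)]

/-- The families `f` with a bifurcation condition associated to `μ`: `f` is invariant under
permutations of `x₁, …, x_ϑ`, smooth in a neighborhood of the origin, has the trivial zero
`f(0, 0, lam) = 0` for all `lam`, and satisfies `f₀ + μ f₁ = 0` with `f₁ ≠ 0` (so that `μ` is the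
only number with `f₀ + μ f₁ = 0`). -/
structure HasBifurcationCondition [NeZero ϑ] (μ : ℝ) (f : CellVars ϑ → ℝ) : Prop where
  symmetric : ∀ (σ : Equiv.Perm (Fin ϑ)) (x₀ : ℝ) (x : Fin ϑ → ℝ) (lam : ℝ),
    f (x₀, x ∘ σ, lam) = f (x₀, x, lam)
  smooth : ∀ᶠ p in 𝓝 (0 : CellVars ϑ), ContDiffAt ℝ ∞ f p
  trivial_zero : ∀ lam : ℝ, f (0, 0, lam) = 0
  critical : coeff0 f + μ * coeff1 f = 0
  coeff1_ne_zero : coeff1 f ≠ 0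

/-- The topology of convergence of all derivatives at the origin. -/
@[reducible] noncomputable def jetTopology (ϑ : ℕ) : TopologicalSpace (CellVars ϑ → ℝ) :=
  TopologicalSpace.induced
    (fun f (n : ℕ) => (iteratedFDeriv ℝ n f 0 : ContinuousMultilinearMap ℝ
      (fun _ : Fin n => CellVars ϑ) ℝ)) inferInstance

/-- `P` holds generically for the families with a bifurcation condition associated to `μ`: it holds
on a relatively open and dense set of such families (a condition on derivatives at the origin). -/
def Generically [NeZero ϑ] (μ : ℝ) (P : (CellVars ϑ → ℝ) → Prop) : Prop :=
  ∃ O : Set (CellVars ϑ → ℝ), IsOpen[jetTopology ϑ] O ∧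
    {f | HasBifurcationCondition μ f} ⊆
      closure[jetTopology ϑ] (O ∩ {f | HasBifurcationCondition μ f}) ∧
    ∀ f ∈ O, HasBifurcationCondition μ f → P f

end Functions

section LyapunovSchmidt

variable {C : Type*} [Fintype C]

/-- The Jacobian `(D F(·, 0))₀` at the origin of a family of vector fields. -/
noncomputable def jacobian (F : (C → ℝ) × ℝ → C → ℝ) : (C → ℝ) →ₗ[ℝ] (C → ℝ) :=
  (fderiv ℝ (fun x => F (x, 0)) 0 : (C → ℝ) →L[ℝ] (C → ℝ))

/-- A Lyapunov-Schmidt reduction of `F = 0` at the origin, with `J` the Jacobian of `F` there: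
a basis `v` of `ker J`, the basis `w` of `(ran J)^⊥` with `⟨w i, v j⟩ = δ_ij`, and the implicit
function `W` with values in `(ker J)^⊥` that solves the projection onto `ran J` of
`F (∑ y_i v_i + W(y, lam), lam) = 0` near the origin. -/
structure LyapunovSchmidt (F : (C → ℝ) × ℝ → C → ℝ) (m : ℕ) where
  v : Module.Basis (Fin m) ℝ (LinearMap.ker (jacobian F))
  w : Fin m → C → ℝ
  w_orth : ∀ i x, w i ⬝ᵥ jacobian F x = 0
  w_dual : ∀ i j, w i ⬝ᵥ (v j : C → ℝ) = if i = j then 1 else 0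
  W : EuclideanSpace ℝ (Fin m) × ℝ → C → ℝ
  W_smooth : ∀ᶠ p in 𝓝 (0 : EuclideanSpace ℝ (Fin m) × ℝ), ContDiffAt ℝ ∞ W p
  W_zero : W 0 = 0
  W_orth : ∀ᶠ p in 𝓝 (0 : EuclideanSpace ℝ (Fin m) × ℝ),
    ∀ x ∈ LinearMap.ker (jacobian F), x ⬝ᵥ W p = 0
  W_solves : ∀ᶠ p in 𝓝 (0 : EuclideanSpace ℝ (Fin m) × ℝ),
    ∀ x, jacobian F x ⬝ᵥ F (∑ i, p.1 i • (v i : C → ℝ) + W p, p.2) = 0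

namespace LyapunovSchmidt

variable {F : (C → ℝ) × ℝ → C → ℝ} {m : ℕ}

/-- The reduced function `g : ℝ^m × ℝ → ℝ^m`. -/
noncomputable def g (R : LyapunovSchmidt F m) (p : EuclideanSpace ℝ (Fin m) × ℝ) :
    EuclideanSpace ℝ (Fin m) :=
  WithLp.toLp 2 fun i => R.w i ⬝ᵥ F (∑ j, p.1 j • (R.v j : C → ℝ) + R.W p, p.2)

/-- `k` is the smallest degree of a nonvanishing homogeneous term in the Taylor expansion of
`y ↦ g(y, 0)` at `0`. -/
def IsOrder (R : LyapunovSchmidt F m) (k : ℕ) : Prop :=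
  IsLeast {l : ℕ | iteratedFDeriv ℝ l (fun y => R.g (y, 0)) 0 ≠ 0} k

/-- The homogeneous term `Q_k` of degree `k` in the Taylor expansion of `y ↦ g(y, 0)` at `0`. -/
noncomputable def Q (R : LyapunovSchmidt F m) (k : ℕ) (u : EuclideanSpace ℝ (Fin m)) :
    EuclideanSpace ℝ (Fin m) :=
  ((k.factorial : ℝ)⁻¹) • iteratedFDeriv ℝ k (fun y => R.g (y, 0)) 0 (fun _ => u)

/-- The blown-up reduced function at `ε = 0`, i.e. `h(u, 0, η) = η a u + Q_k(u)`, where `a` stands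
for `f_{0lam} + μ f_{1lam}`. -/
noncomputable def h (R : LyapunovSchmidt F m) (a : ℝ) (k : ℕ) (u : EuclideanSpace ℝ (Fin m))
    (η : ℝ) : EuclideanSpace ℝ (Fin m) :=
  (η * a) • u + R.Q k u

/-- The value of `η` for which the radial component of `h(u, 0, η)` vanishes. -/
noncomputable def etaTilde (R : LyapunovSchmidt F m) (a : ℝ) (k : ℕ)
    (u : EuclideanSpace ℝ (Fin m)) : ℝ :=
  -(inner ℝ (R.Q k u) u) / a

/-- The vector field on the sphere. -/
noncomputable def hTilde (R : LyapunovSchmidt F m) (a : ℝ) (k : ℕ)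
    (u : EuclideanSpace ℝ (Fin m)) : EuclideanSpace ℝ (Fin m) :=
  R.h a k u (R.etaTilde a k u)

/-- The derivative of `(u, η) ↦ h(u, 0, η)` on `S^{m-1} × ℝ` at `(u, etaTilde u)`, a linear map
from `T_u S^{m-1} × ℝ = u^⊥ × ℝ` to `ℝ^m`, is non-singular. -/
def H2 (R : LyapunovSchmidt F m) (a : ℝ) (k : ℕ) (u : EuclideanSpace ℝ (Fin m)) : Prop :=
  Function.Bijective fun q : (Submodule.span ℝ {u})ᗮ × ℝ =>
    fderiv ℝ (fun p : EuclideanSpace ℝ (Fin m) × ℝ => R.h a k p.1 p.2) (u, R.etaTilde a k u)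
      ((q.1 : EuclideanSpace ℝ (Fin m)), q.2)

/-- Every zero of the vector field on the sphere is non-singular in the sense of `H2`. -/
def H1 (R : LyapunovSchmidt F m) (a : ℝ) (k : ℕ) : Prop :=
  ∀ u : EuclideanSpace ℝ (Fin m), ‖u‖ = 1 → R.hTilde a k u = 0 → R.H2 a k u

end LyapunovSchmidt

end LyapunovSchmidt

namespace RegularNetwork

variable {C E : Type*} [Fintype C] [Finite E] {ϑ : ℕ}

/-- `k(N, f) = k`. The order does not depend on the Lyapunov-Schmidt reduction. -/
def HasOrder (N : RegularNetwork C E ϑ) (f : CellVars ϑ → ℝ) (k : ℕ) : Prop :=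
  (∃ m, Nonempty (LyapunovSchmidt (N.vectorField f) m)) ∧
    ∀ m (R : LyapunovSchmidt (N.vectorField f) m), R.IsOrder k

/-- `k(N, μ) = k`: the generic value of `k(N, f)` for the families `f` with a bifurcation condition
associated to `μ`. -/
def HasGenericOrder [NeZero ϑ] (N : RegularNetwork C E ϑ) (μ : ℝ) (k : ℕ) : Prop :=
  Generically μ fun f : CellVars ϑ → ℝ => N.HasOrder f k

/-- Condition (H1) for `f` and `N`, where `k = k(N, μ)`. It does not depend on the Lyapunov-Schmidt
reduction. -/
def ConditionH1 [NeZero ϑ] (N : RegularNetwork C E ϑ) (f : CellVars ϑ → ℝ) (μ : ℝ) (k : ℕ) :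
    Prop :=
  ∃ m, ∃ R : LyapunovSchmidt (N.vectorField f) m, R.H1 (coeff0Lam f + μ * coeff1Lam f) k

/-- The restriction of `b = (b_N, b_lam)` to `[0, δ)` is a bifurcation branch of `f` on `N`. -/
structure IsBifurcationBranch (N : RegularNetwork C E ϑ) (f : CellVars ϑ → ℝ) (δ : ℝ)
    (b : ℝ → (C → ℝ) × ℝ) : Prop where
  pos : 0 < δ
  differentiable : DifferentiableOn ℝ b (Ico 0 δ)
  zero : b 0 = 0
  lam_ne_zero : ∀ z ∈ Ioo 0 δ, (b z).2 ≠ 0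
  equilibrium : ∀ z ∈ Ioo 0 δ, N.vectorField f (b z) = 0
  nontrivial : ∀ z ∈ Ioo 0 δ, (b z).1 ≠ 0

/-- The restriction of `b = (b_N, b_lam)` to `[0, δ)` has exactly synchrony `r`: `b_N([0, δ))` lies
in the polydiagonal of `r`, but not in that of any balanced coloring strictly refined by `r`. -/
def HasExactSynchrony (N : RegularNetwork C E ϑ) (r : Setoid C) (δ : ℝ)
    (b : ℝ → (C → ℝ) × ℝ) : Prop :=
  (∀ z ∈ Ico 0 δ, (b z).1 ∈ polydiagonal r) ∧
    ∀ r' : Setoid C, N.IsBalanced r' → r < r' → ¬ ∀ z ∈ Ico 0 δ, (b z).1 ∈ polydiagonal r'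

end RegularNetwork

/-!
The quotient network `N/r` carries the dynamics of `N` on the polydiagonal of `r`, so the branch is
sought on `N/r`, where the Lyapunov-Schmidt reduced function is `g : ℝ² × ℝ → ℝ²` (the kernel of the
Jacobian in the polydiagonal is the kernel for `N/r`, hence two-dimensional).

Two facts about `g` are needed. It vanishes for `y = 0`, because the implicit function `W` vanishes
there (`LyapunovSchmidt.eventually_W_zero_eq_zero`), and its mixed derivative at the origin is `a`
times the identity, where `a` is the crossing speed `f_{0lam} + μ f_{1lam}`: the vectors `w_i` are
left eigenvectors of the linearization along the trivial branch
(`RegularNetwork.hasDerivAt_fderiv_g`). Together with the vanishing of the Taylor terms of degree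
less than `k` this shows that `g (ε u, ε ^ (k - 1) η) = ε ^ k H (u, η, ε)` with `H` smooth and
`H (u, η, 0) = η a u + Q_k u` (`exists_smooth_blowUp`); the divisions are instances of Hadamard's
lemma (`SmoothNear.exists_eq_smul`).

Since `k` is even, `Q_k` is an even vector field on the circle. In the frame rotating with `u` its
tangential component is odd, so it vanishes at some `u₀`
(`exists_tangential_zero_of_even`). By condition (H1) the corresponding zero of `H (·, ·, 0)` is
non-degenerate, and the inverse function theorem, applied to `(u, η, ε) ↦ (H, ‖u‖², ε)`, continues
it to a curve of zeros of `g` (`exists_zero_curve`).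

Along this curve `lam ≠ 0` because the origin is an isolated zero for `lam = 0`. The synchrony is
exact: if `r'` is balanced and strictly coarser than `r`, then `μ` is not an eigenvalue of `N/r'`,
the Jacobian of `N/r'` is injective, and the only zeros near the origin in the polydiagonal of `r'` are
the trivial ones (`RegularNetwork.eventually_eq_zero_of_mem_polydiagonal`).

The generic set is the one on which the order `k` is attained, intersected with `a ≠ 0`; the latter
condition is open, and it is dense because adding `e * lam * x₀` to `f` changes `a` by `e`
(`Generically.and_crossingSpeed_ne_zero`).
-/

/-! ### Smooth germs and Hadamard's lemma -/

/-- `f` is smooth at all points of a neighbourhood of `x`. -/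
def SmoothNear {X Y : Type*} [NormedAddCommGroup X] [NormedSpace ℝ X] [NormedAddCommGroup Y]
    [NormedSpace ℝ Y] (f : X → Y) (x : X) : Prop :=
  ∀ᶠ y in 𝓝 x, ContDiffAt ℝ ∞ f y

section Smooth

open MeasureTheory

variable {X Y Z : Type*} [NormedAddCommGroup X] [NormedSpace ℝ X] [NormedAddCommGroup Y]
  [NormedSpace ℝ Y] [NormedAddCommGroup Z] [NormedSpace ℝ Z]

theorem SmoothNear.contDiffAt {f : X → Y} {x : X} (h : SmoothNear f x) : ContDiffAt ℝ ∞ f x :=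
  h.self_of_nhds

theorem SmoothNear.continuousAt {f : X → Y} {x : X} (h : SmoothNear f x) : ContinuousAt f x :=
  h.contDiffAt.continuousAt

theorem SmoothNear.differentiableAt {f : X → Y} {x : X} (h : SmoothNear f x) :
    DifferentiableAt ℝ f x :=
  h.contDiffAt.differentiableAt (by simp)

theorem ContDiff.smoothNear {f : X → Y} (h : ContDiff ℝ ∞ f) (x : X) : SmoothNear f x :=
  Eventually.of_forall fun _ => h.contDiffAt

theorem SmoothNear.eventually_smoothNear {f : X → Y} {x : X} (h : SmoothNear f x) :
    ∀ᶠ y in 𝓝 x, SmoothNear f y :=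
  eventually_eventually_nhds.2 h

theorem SmoothNear.comp {g : Y → Z} {f : X → Y} {x : X} (hg : SmoothNear g (f x))
    (hf : SmoothNear f x) : SmoothNear (fun z => g (f z)) x := by
  filter_upwards [hf, hf.continuousAt.eventually hg] with z h1 h2
  exact ContDiffAt.comp z h2 h1

theorem SmoothNear.fderiv {f : X → Y} {x : X} (hf : SmoothNear f x) :
    SmoothNear (fderiv ℝ f) x := by
  filter_upwards [hf] with z h
  exact h.fderiv_right (m := ∞) (by simp)

/-- The integral is the value at `0` of the convolution of the indicator function of `(0, 1]` with
`s ↦ χ s • f x (-s)`, where the cutoff `χ` is `1` on `[-1, 1]`. -/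
theorem ContDiff.parametric_integral_unitInterval {f : X → ℝ → Y} [CompleteSpace Y]
    (hf : ContDiff ℝ ∞ (fun p : X × ℝ => f p.1 p.2)) :
    ContDiff ℝ ∞ fun x => ∫ t in (0 : ℝ)..1, f x t := by
  let χ : ContDiffBump (0 : ℝ) := ⟨1, 2, one_pos, one_lt_two⟩
  have key := contDiffOn_convolution_right_with_param_comp (𝕜 := ℝ) (μ := (volume : Measure ℝ))
    (n := ⊤) (ContinuousLinearMap.lsmul ℝ ℝ : ℝ →L[ℝ] Y →L[ℝ] Y) (s := (univ : Set X))
    (v := fun _ => (0 : ℝ)) contDiffOn_const (f := (Ioc (0 : ℝ) 1).indicator fun _ => (1 : ℝ))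
    (g := fun x s => χ s • f x (-s)) (k := Metric.closedBall 0 2) isOpen_univ
    (isCompact_closedBall 0 2) ?_ ?_ ?_
  · rw [contDiffOn_univ] at key
    convert key using 1
    funext x
    rw [intervalIntegral.integral_of_le zero_le_one, ← integral_indicator measurableSet_Ioc]
    refine integral_congr_ae (Eventually.of_forall fun t => ?_)
    by_cases ht : t ∈ Ioc (0 : ℝ) 1
    · have h1 : χ (-t) = 1 := χ.one_of_mem_closedBall (by
        have : |t| ≤ 1 := abs_le.2 ⟨by linarith [ht.1], ht.2⟩
        simpa [χ] using this)
      simp [ht, h1]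
    · simp [ht]
  · intro x s _ hs
    have : χ s = 0 := χ.zero_of_le_dist (by
      simp only [Metric.mem_closedBall, not_le] at hs
      exact hs.le)
    simp [this]
  · exact ((locallyIntegrable_const (1 : ℝ)).indicator measurableSet_Ioc)
  · refine ContDiff.contDiffOn ?_
    have h1 : ContDiff ℝ ∞ fun q : X × ℝ => f q.1 (-q.2) :=
      hf.comp (contDiff_fst.prodMk contDiff_snd.neg)
    have h2 : ContDiff ℝ ∞ fun q : X × ℝ => χ q.2 := χ.contDiff.comp contDiff_snd
    exact h2.smul h1

/-- The quotient is `∫ t in 0..1, ∂_ε φ (x, t ε)`. -/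
theorem ContDiff.exists_eq_smul [CompleteSpace Y] {φ : X × ℝ → Y} (hφ : ContDiff ℝ ∞ φ) :
    ∃ ψ : X × ℝ → Y, ContDiff ℝ ∞ ψ ∧ ∀ q, φ q - φ (q.1, 0) = q.2 • ψ q := by
  refine ⟨fun q => ∫ t in (0 : ℝ)..1, fderiv ℝ φ (q.1, t * q.2) (0, 1), ?_, fun q => ?_⟩
  · apply ContDiff.parametric_integral_unitInterval
    have h1 : ContDiff ℝ ∞ (fderiv ℝ φ) := hφ.fderiv_right (by simp)
    have h2 : ContDiff ℝ ∞ fun p : (X × ℝ) × ℝ => ((p.1.1, p.2 * p.1.2) : X × ℝ) := by fun_prop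
    exact (h1.comp h2).clm_apply contDiff_const
  · have hd : ∀ t ∈ uIcc (0 : ℝ) 1, HasDerivAt (fun t => φ (q.1, t * q.2))
        (q.2 • fderiv ℝ φ (q.1, t * q.2) (0, 1)) t := by
      intro t _
      have h1 : HasDerivAt (fun t : ℝ => ((q.1, t * q.2) : X × ℝ)) (0, q.2) t := by
        have := (hasDerivAt_id t).mul_const q.2
        simp only [one_mul] at this
        exact (hasDerivAt_const t q.1).prodMk this
      have h2 := ((hφ.differentiable (by simp)) (q.1, t * q.2)).hasFDerivAt.comp_hasDerivAt t h1
      have h3 : ((0 : X), q.2) = q.2 • ((0 : X), (1 : ℝ)) := by simp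
      rw [h3, map_smul] at h2
      exact h2
    have hc : Continuous fun t : ℝ => q.2 • fderiv ℝ φ (q.1, t * q.2) (0, 1) := by
      have h1 : ContDiff ℝ ∞ (fderiv ℝ φ) := hφ.fderiv_right (by simp)
      have h2 : Continuous fun t : ℝ => ((q.1, t * q.2) : X × ℝ) := by fun_prop
      exact ((h1.continuous.comp h2).clm_apply continuous_const).const_smul _
    have := intervalIntegral.integral_eq_sub_of_hasDerivAt hd (hc.intervalIntegrable 0 1)
    rw [intervalIntegral.integral_smul] at this
    simp only [one_mul, zero_mul] at this
    exact this.symm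

/-- A function that is smooth near a point agrees near that point with a globally smooth one. -/
theorem SmoothNear.exists_contDiff [FiniteDimensional ℝ X] {φ : X → Y} {x : X}
    (hφ : SmoothNear φ x) : ∃ φ' : X → Y, ContDiff ℝ ∞ φ' ∧ φ' =ᶠ[𝓝 x] φ := by
  obtain ⟨R, hR, hball⟩ := Metric.eventually_nhds_iff_ball.1 hφ
  let χ : ContDiffBump x := ⟨R / 3, R / 2, by positivity, by linarith⟩
  refine ⟨fun z => χ z • φ z, ?_, ?_⟩
  · rw [contDiff_iff_contDiffAt]
    intro z
    by_cases hz : z ∈ Metric.ball x R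
    · exact χ.contDiffAt.smul (hball z hz)
    · have hzs : z ∉ tsupport χ := by
        rw [χ.tsupport_eq]
        intro h
        have h1 : dist z x ≤ R / 2 := h
        have h2 : ¬ dist z x < R := hz
        linarith
      have : (fun z => χ z • φ z) =ᶠ[𝓝 z] fun _ => 0 := by
        filter_upwards [notMem_tsupport_iff_eventuallyEq.1 hzs] with w hw
        simp [hw]
      exact contDiffAt_const.congr_of_eventuallyEq this
  · filter_upwards [χ.eventuallyEq_one] with z hz
    simp [hz]

/-- **Hadamard's lemma** with parameters: a smooth function vanishing for `ε = 0` is divisible by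
the coordinate `ε` in the ring of germs of smooth functions. -/
theorem SmoothNear.exists_eq_smul [FiniteDimensional ℝ X] [CompleteSpace Y] {φ : X × ℝ → Y} {x : X}
    (hφ : SmoothNear φ (x, 0)) (h0 : ∀ᶠ y in 𝓝 x, φ (y, 0) = 0) :
    ∃ ψ : X × ℝ → Y, SmoothNear ψ (x, 0) ∧ ∀ᶠ q in 𝓝 (x, (0 : ℝ)), φ q = q.2 • ψ q := by
  obtain ⟨φ', hφ', heq⟩ := hφ.exists_contDiff
  obtain ⟨ψ, hψ, h⟩ := hφ'.exists_eq_smul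
  refine ⟨ψ, hψ.smoothNear _, ?_⟩
  have hc : Tendsto (fun q : X × ℝ => (q.1, (0 : ℝ))) (𝓝 (x, 0)) (𝓝 (x, 0)) :=
    Continuous.tendsto (f := fun q : X × ℝ => (q.1, (0 : ℝ))) (by fun_prop) (x, 0)
  have hfst : Tendsto (fun q : X × ℝ => q.1) (𝓝 (x, 0)) (𝓝 x) := continuous_fst.tendsto (x, (0:ℝ))
  filter_upwards [heq, hc.eventually heq, hfst.eventually h0] with q h1 h2 h3
  rw [← h q, h1, h2, h3, sub_zero]

theorem iteratedDeriv_pow_smul_zero (j : ℕ) {q : ℝ → Y} (hq : SmoothNear q 0) :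
    iteratedDeriv j (fun s => s ^ j • q s) 0 = (j.factorial : ℝ) • q 0 := by
  induction j generalizing q with
  | zero => simp
  | succ j ih =>
    rw [iteratedDeriv_succ']
    have hd : SmoothNear (deriv q) 0 := by
      filter_upwards [hq.fderiv] with s hs
      exact hs.clm_apply contDiffAt_const
    have h1 : deriv (fun s : ℝ => s ^ (j + 1) • q s) =ᶠ[𝓝 0]
        fun s => s ^ j • (((j : ℝ) + 1) • q s + s • deriv q s) := by
      filter_upwards [hq.eventually_smoothNear] with s hs
      have := ((hasDerivAt_pow (j + 1) s).smul hs.differentiableAt.hasDerivAt).deriv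
      refine Eq.trans this ?_
      simp only [Nat.add_sub_cancel, Nat.cast_add, Nat.cast_one]
      rw [smul_add, smul_smul, smul_smul, add_comm]
      congr 2
      ring
    rw [h1.iteratedDeriv_eq, ih]
    · rw [Nat.factorial_succ]
      simp [smul_smul, mul_comm]
    · filter_upwards [hq, hd] with s h2 h3
      exact (contDiffAt_const.smul h2).add (contDiffAt_id.smul h3)

theorem iteratedDeriv_comp_smul_zero [FiniteDimensional ℝ X] {G : X → Y} (hG : SmoothNear G 0)
    (u : X) (j : ℕ) :
    iteratedDeriv j (fun s : ℝ => G (s • u)) 0 = iteratedFDeriv ℝ j G 0 fun _ => u := by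
  obtain ⟨G', hG', heq⟩ := hG.exists_contDiff
  have hc : Tendsto (fun s : ℝ => s • u) (𝓝 0) (𝓝 0) := by
    simpa using Continuous.tendsto (f := fun s : ℝ => s • u) (by fun_prop) 0
  have h1 : (fun s : ℝ => G (s • u)) =ᶠ[𝓝 0] G' ∘ ContinuousLinearMap.toSpanSingleton ℝ u := by
    filter_upwards [hc.eventually heq] with s hs
    simp [hs]
  rw [h1.iteratedDeriv_eq, iteratedDeriv_eq_iteratedFDeriv,
    ContinuousLinearMap.iteratedFDeriv_comp_right _ hG' 0 (by exact_mod_cast le_top),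
    ← (heq.iteratedFDeriv ℝ j).self_of_nhds]
  simp

/-- If the derivatives of order less than `k` of `G` vanish at `0`, then `G (ε u) = ε ^ k q (u, ε)`
with `q` smooth, and `q (u, 0)` is the homogeneous Taylor term of degree `k`. -/
theorem SmoothNear.exists_eq_pow_smul [FiniteDimensional ℝ X] [CompleteSpace Y] {G : X → Y}
    (hG : SmoothNear G 0) (k : ℕ) (hk : ∀ l < k, iteratedFDeriv ℝ l G 0 = 0) (u : X) :
    ∃ q : X × ℝ → Y, SmoothNear q (u, 0) ∧
      (∀ᶠ p in 𝓝 (u, (0 : ℝ)), G (p.2 • p.1) = p.2 ^ k • q p) ∧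
      ∀ᶠ v in 𝓝 u, q (v, 0) = (k.factorial : ℝ)⁻¹ • iteratedFDeriv ℝ k G 0 fun _ => v := by
  have value : ∀ (j : ℕ) (q : X × ℝ → Y), SmoothNear q (u, 0) →
      (∀ᶠ p in 𝓝 (u, (0 : ℝ)), G (p.2 • p.1) = p.2 ^ j • q p) →
      ∀ᶠ v in 𝓝 u, q (v, 0) = (j.factorial : ℝ)⁻¹ • iteratedFDeriv ℝ j G 0 fun _ => v := by
    intro j q hq hGq
    have hc : Tendsto (fun v : X => (v, (0 : ℝ))) (𝓝 u) (𝓝 (u, 0)) :=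
      Continuous.tendsto (f := fun v : X => (v, (0 : ℝ))) (by fun_prop) u
    filter_upwards [hc.eventually hq.eventually_smoothNear,
      hc.eventually (eventually_eventually_nhds.2 hGq)] with v h1 h2
    have hs : Tendsto (fun s : ℝ => (v, s)) (𝓝 0) (𝓝 (v, 0)) :=
      Continuous.tendsto (f := fun s : ℝ => (v, s)) (by fun_prop) 0
    have h3 : (fun s : ℝ => G (s • v)) =ᶠ[𝓝 0] fun s => s ^ j • q (v, s) := hs.eventually h2
    have h4 := iteratedDeriv_pow_smul_zero j
      (SmoothNear.comp (f := fun s : ℝ => (v, s)) h1 (ContDiff.smoothNear (by fun_prop) 0))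
    rw [← iteratedDeriv_comp_smul_zero hG, h3.iteratedDeriv_eq, h4, smul_smul,
      inv_mul_cancel₀ (by exact_mod_cast j.factorial_ne_zero), one_smul]
  have main : ∀ j ≤ k, ∃ q : X × ℝ → Y, SmoothNear q (u, 0) ∧
      ∀ᶠ p in 𝓝 (u, (0 : ℝ)), G (p.2 • p.1) = p.2 ^ j • q p := by
    intro j
    induction j with
    | zero =>
      intro _
      refine ⟨fun p => G (p.2 • p.1), ?_, by simp⟩
      exact SmoothNear.comp (f := fun p : X × ℝ => p.2 • p.1) (by simpa using hG)
        (ContDiff.smoothNear (contDiff_snd.smul contDiff_fst) _)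
    | succ j ih =>
      intro hj
      obtain ⟨q, hq, hGq⟩ := ih (by omega)
      obtain ⟨q', hq', hqq'⟩ := hq.exists_eq_smul (by
        filter_upwards [value j q hq hGq] with v hv
        rw [hv, hk j (by omega)]
        simp)
      refine ⟨q', hq', ?_⟩
      filter_upwards [hGq, hqq'] with p h1 h2
      rw [h1, h2, smul_smul, pow_succ]
  obtain ⟨q, hq, hGq⟩ := main k le_rfl
  exact ⟨q, hq, hGq, value k q hq hGq⟩

end Smooth

/-! ### The inverse function theorem and the blow-up -/

/-- The inverse function theorem, in the form used below: the local inverse is differentiable at all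
points of a neighbourhood. -/
theorem SmoothNear.exists_local_rightInverse {X : Type*} [NormedAddCommGroup X] [NormedSpace ℝ X]
    [FiniteDimensional ℝ X] {Φ : X → X} {x : X} (hΦ : SmoothNear Φ x)
    (hinj : ∀ v, _root_.fderiv ℝ Φ x v = 0 → v = 0) :
    ∃ c : X → X, c (Φ x) = x ∧ (∀ᶠ y in 𝓝 (Φ x), DifferentiableAt ℝ c y) ∧
      ∀ᶠ y in 𝓝 (Φ x), Φ (c y) = y := by
  have : CompleteSpace X := FiniteDimensional.complete ℝ X
  have hinj' : Function.Injective (_root_.fderiv ℝ Φ x : X →ₗ[ℝ] X) :=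
    (injective_iff_map_eq_zero _).2 hinj
  let e : X ≃L[ℝ] X := (LinearEquiv.ofInjectiveEndo _ hinj').toContinuousLinearEquiv
  have he : (e : X →L[ℝ] X) = _root_.fderiv ℝ Φ x := by
    ext v
    rfl
  have h1 : ContDiffAt ℝ 1 Φ x := hΦ.contDiffAt.of_le (by exact_mod_cast le_top)
  have h2 : HasFDerivAt Φ (e : X →L[ℝ] X) x := he ▸ hΦ.differentiableAt.hasFDerivAt
  refine ⟨h1.localInverse h2 one_ne_zero, h1.localInverse_apply_image h2 one_ne_zero, ?_, ?_⟩
  · filter_upwards [(h1.to_localInverse h2 one_ne_zero).eventually (by simp)] with y hy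
    exact hy.differentiableAt one_ne_zero
  · exact (h1.hasStrictFDerivAt' h2 one_ne_zero).eventually_right_inverse

theorem DifferentiableAt.hasDerivAt_id_smul_zero {Y : Type*} [NormedAddCommGroup Y]
    [NormedSpace ℝ Y] {K : ℝ → Y} (hK : DifferentiableAt ℝ K 0) :
    HasDerivAt (fun s => s • K s) (K 0) 0 := by
  have := (hasDerivAt_id (0 : ℝ)).smul hK.hasDerivAt
  simp only [id, zero_smul, one_smul, zero_add] at this
  exact this

section BlowUp

variable {E : Type*} [NormedAddCommGroup E] [InnerProductSpace ℝ E] [FiniteDimensional ℝ E]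

/-- The homogeneous term of degree `k` in the Taylor expansion at the origin of `y ↦ G (y, 0)`. -/
noncomputable def taylorTerm (G : E × ℝ → E) (k : ℕ) (u : E) : E :=
  (k.factorial : ℝ)⁻¹ • iteratedFDeriv ℝ k (fun y => G (y, 0)) 0 fun _ => u

/-- Blow-up at the origin: with `y = ε u` and `lam = ε ^ (k - 1) η`, the function `G` is divisible
by `ε ^ k`, and the quotient `H` is smooth, with `H (u, η, 0) = η a u + Q_k u`. -/
theorem exists_smooth_blowUp {G : E × ℝ → E} (hG : SmoothNear G 0)
    (h0 : ∀ᶠ l in 𝓝 (0 : ℝ), G (0, l) = 0) {a : ℝ}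
    (ha : ∀ u, HasDerivAt (fun l => fderiv ℝ (fun y => G (y, l)) 0 u) (a • u) 0) {k : ℕ}
    (hk : 2 ≤ k) (hlow : ∀ l < k, iteratedFDeriv ℝ l (fun y => G (y, 0)) 0 = 0) (u₀ : E) (η₀ : ℝ) :
    ∃ H : (E × ℝ) × ℝ → E, SmoothNear H ((u₀, η₀), 0) ∧
      (∀ᶠ p in 𝓝 ((u₀, η₀), (0 : ℝ)), G (p.2 • p.1.1, p.2 ^ (k - 1) * p.1.2) = p.2 ^ k • H p) ∧
      ∀ᶠ q in 𝓝 (u₀, η₀), H (q, 0) = (q.2 * a) • q.1 + taylorTerm G k q.1 := by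
  have : CompleteSpace E := FiniteDimensional.complete ℝ E
  have hG0 : SmoothNear (fun y => G (y, 0)) 0 :=
    SmoothNear.comp (f := fun y : E => (y, (0 : ℝ))) hG (ContDiff.smoothNear (by fun_prop) 0)
  obtain ⟨q, hq, hGq, hq0⟩ := hG0.exists_eq_pow_smul k hlow u₀
  -- first division: `G (ε u, l) = ε K (u, l, ε)`
  obtain ⟨K, hK, hGK⟩ := SmoothNear.exists_eq_smul (X := E × ℝ) (x := (u₀, 0))
    (φ := fun p => G (p.2 • p.1.1, p.1.2))
    (SmoothNear.comp (f := fun p : (E × ℝ) × ℝ => (p.2 • p.1.1, p.1.2))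
      (by simpa [← Prod.zero_eq_mk] using hG)
      (ContDiff.smoothNear (by fun_prop) _))
    (by
      have : Tendsto (fun p : E × ℝ => p.2) (𝓝 (u₀, 0)) (𝓝 0) := continuous_snd.tendsto (u₀, (0:ℝ))
      filter_upwards [this.eventually h0] with p hp
      simpa using hp)
  -- second division: `K (u, l, ε) = K (u, 0, ε) + l M (u, ε, l)`
  obtain ⟨M, hM, hKM⟩ := SmoothNear.exists_eq_smul (X := E × ℝ) (x := (u₀, 0))
    (φ := fun p => K ((p.1.1, p.2), p.1.2) - K ((p.1.1, 0), p.1.2))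
    (by
      have h1 : SmoothNear (fun p : (E × ℝ) × ℝ => K ((p.1.1, p.2), p.1.2)) ((u₀, 0), 0) :=
        SmoothNear.comp (f := fun p : (E × ℝ) × ℝ => ((p.1.1, p.2), p.1.2)) hK
          (ContDiff.smoothNear (by fun_prop) _)
      have h2 : SmoothNear (fun p : (E × ℝ) × ℝ => K ((p.1.1, 0), p.1.2)) ((u₀, 0), 0) :=
        SmoothNear.comp (f := fun p : (E × ℝ) × ℝ => ((p.1.1, (0 : ℝ)), p.1.2)) hK
          (ContDiff.smoothNear (by fun_prop) _)
      filter_upwards [h1, h2] with p h3 h4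
      exact h3.sub h4)
    (Eventually.of_forall fun p => by simp)
  -- on the exceptional divisor `K` is the derivative of `G (·, l)`, so `M` is its `l`-derivative
  have hKd : ∀ᶠ p in 𝓝 (u₀, (0 : ℝ)), K (p, 0) = fderiv ℝ (fun y => G (y, p.2)) 0 p.1 := by
    have hc : Tendsto (fun p : E × ℝ => (p, (0 : ℝ))) (𝓝 (u₀, 0)) (𝓝 ((u₀, 0), 0)) :=
      Continuous.tendsto (f := fun p : E × ℝ => (p, (0 : ℝ))) (by fun_prop) (u₀, 0)
    have hc' : Tendsto (fun p : E × ℝ => ((0 : E), p.2)) (𝓝 (u₀, 0)) (𝓝 0) :=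
      Continuous.tendsto (f := fun p : E × ℝ => ((0 : E), p.2)) (by fun_prop) (u₀, 0)
    filter_upwards [hc.eventually hK.eventually_smoothNear,
      hc.eventually (eventually_eventually_nhds.2 hGK), hc'.eventually hG] with p h1 h2 h3
    have hs : Tendsto (fun s : ℝ => (p, s)) (𝓝 0) (𝓝 (p, 0)) :=
      Continuous.tendsto (f := fun s : ℝ => (p, s)) (by fun_prop) 0
    have h4 : (fun s : ℝ => G (s • p.1, p.2)) =ᶠ[𝓝 0] fun s => s • K (p, s) := hs.eventually h2
    have h5 : HasDerivAt (fun s : ℝ => s • K (p, s)) (K (p, 0)) 0 := by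
      have h6 : DifferentiableAt ℝ (fun s : ℝ => K (p, s)) 0 :=
        (SmoothNear.comp (f := fun s : ℝ => (p, s)) h1
          (ContDiff.smoothNear (by fun_prop) 0)).differentiableAt
      exact h6.hasDerivAt_id_smul_zero
    have h7 : DifferentiableAt ℝ (fun y => G (y, p.2)) ((0 : ℝ) • p.1) := by
      rw [zero_smul]
      exact DifferentiableAt.comp (f := fun y : E => (y, p.2)) 0
        (h3.differentiableAt (by simp)) (by fun_prop)
    have h8 : HasDerivAt (fun s : ℝ => G (s • p.1, p.2))
        (fderiv ℝ (fun y => G (y, p.2)) 0 p.1) 0 := by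
      have h9 : HasDerivAt (fun s : ℝ => s • p.1) p.1 0 := by
        simpa using (hasDerivAt_id (0 : ℝ)).smul_const p.1
      have := h7.hasFDerivAt.comp_hasDerivAt (0 : ℝ) h9
      rw [zero_smul] at this
      exact this
    exact (h5.congr_of_eventuallyEq h4).unique h8
  have hM0 : ∀ᶠ v in 𝓝 u₀, M ((v, 0), 0) = a • v := by
    have hc : Tendsto (fun v : E => ((v, (0 : ℝ)), (0 : ℝ))) (𝓝 u₀) (𝓝 ((u₀, 0), 0)) :=
      Continuous.tendsto (f := fun v : E => ((v, (0 : ℝ)), (0 : ℝ))) (by fun_prop) u₀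
    have hc' : Tendsto (fun v : E => (v, (0 : ℝ))) (𝓝 u₀) (𝓝 (u₀, 0)) :=
      Continuous.tendsto (f := fun v : E => (v, (0 : ℝ))) (by fun_prop) u₀
    filter_upwards [hc.eventually hM.eventually_smoothNear,
      hc.eventually (eventually_eventually_nhds.2 hKM),
      hc'.eventually (eventually_eventually_nhds.2 hKd)] with v h1 h2 h3
    have hs : Tendsto (fun s : ℝ => ((v, (0 : ℝ)), s)) (𝓝 0) (𝓝 ((v, 0), 0)) :=
      Continuous.tendsto (f := fun s : ℝ => ((v, (0 : ℝ)), s)) (by fun_prop) 0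
    have hs' : Tendsto (fun s : ℝ => (v, s)) (𝓝 0) (𝓝 (v, 0)) :=
      Continuous.tendsto (f := fun s : ℝ => (v, s)) (by fun_prop) 0
    have h4 : (fun s : ℝ => fderiv ℝ (fun y => G (y, s)) 0 v - K ((v, 0), 0)) =ᶠ[𝓝 0]
        fun s => s • M ((v, 0), s) := by
      filter_upwards [hs.eventually h2, hs'.eventually h3] with s h5 h6
      rw [← h5, ← h6]
    have h5 : HasDerivAt (fun s : ℝ => s • M ((v, 0), s)) (M ((v, 0), 0)) 0 := by
      have h6 : DifferentiableAt ℝ (fun s : ℝ => M ((v, 0), s)) 0 :=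
        (SmoothNear.comp (f := fun s : ℝ => ((v, (0 : ℝ)), s)) h1
          (ContDiff.smoothNear (by fun_prop) 0)).differentiableAt
      exact h6.hasDerivAt_id_smul_zero
    exact (h5.congr_of_eventuallyEq h4).unique ((ha v).sub_const _)
  have hk1 : k - 1 ≠ 0 := by omega
  refine ⟨fun p => q (p.1.1, p.2) + p.1.2 • M ((p.1.1, p.2), p.2 ^ (k - 1) * p.1.2), ?_, ?_, ?_⟩
  · have h1 : SmoothNear (fun p : (E × ℝ) × ℝ => q (p.1.1, p.2)) ((u₀, η₀), 0) :=
      SmoothNear.comp (f := fun p : (E × ℝ) × ℝ => (p.1.1, p.2)) hq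
        (ContDiff.smoothNear (by fun_prop) _)
    have h2 : SmoothNear (fun p : (E × ℝ) × ℝ => M ((p.1.1, p.2), p.2 ^ (k - 1) * p.1.2))
        ((u₀, η₀), 0) :=
      SmoothNear.comp (f := fun p : (E × ℝ) × ℝ => ((p.1.1, p.2), p.2 ^ (k - 1) * p.1.2))
        (by simpa [hk1] using hM) (ContDiff.smoothNear (by fun_prop) _)
    filter_upwards [h1, h2] with p h3 h4
    exact h3.add (ContDiffAt.smul (by fun_prop) h4)
  · have hc1 : Tendsto (fun p : (E × ℝ) × ℝ => (p.1.1, p.2)) (𝓝 ((u₀, η₀), 0)) (𝓝 (u₀, 0)) :=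
      Continuous.tendsto (f := fun p : (E × ℝ) × ℝ => (p.1.1, p.2)) (by fun_prop) ((u₀, η₀), 0)
    have hc2 : Tendsto (fun p : (E × ℝ) × ℝ => ((p.1.1, (0 : ℝ)), p.2)) (𝓝 ((u₀, η₀), 0))
        (𝓝 ((u₀, 0), 0)) :=
      Continuous.tendsto (f := fun p : (E × ℝ) × ℝ => ((p.1.1, (0 : ℝ)), p.2)) (by fun_prop)
        ((u₀, η₀), 0)
    have hc3 : Tendsto (fun p : (E × ℝ) × ℝ => ((p.1.1, p.2 ^ (k - 1) * p.1.2), p.2))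
        (𝓝 ((u₀, η₀), 0)) (𝓝 ((u₀, 0), 0)) := by
      simpa [hk1] using Continuous.tendsto
        (f := fun p : (E × ℝ) × ℝ => ((p.1.1, p.2 ^ (k - 1) * p.1.2), p.2)) (by fun_prop)
        ((u₀, η₀), 0)
    have hc4 : Tendsto (fun p : (E × ℝ) × ℝ => ((p.1.1, p.2), p.2 ^ (k - 1) * p.1.2))
        (𝓝 ((u₀, η₀), 0)) (𝓝 ((u₀, 0), 0)) := by
      simpa [hk1] using Continuous.tendsto
        (f := fun p : (E × ℝ) × ℝ => ((p.1.1, p.2), p.2 ^ (k - 1) * p.1.2)) (by fun_prop)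
        ((u₀, η₀), 0)
    filter_upwards [hc1.eventually hGq, hc2.eventually hGK, hc3.eventually hGK,
      hc4.eventually hKM] with p h1 h2 h3 h4
    rw [sub_eq_iff_eq_add] at h4
    rw [h3, h4, smul_add, ← h2, h1, smul_add, smul_smul, smul_smul, add_comm]
    congr 2
    obtain ⟨j, rfl⟩ : ∃ j, k = j + 1 := ⟨k - 1, by omega⟩
    simp only [Nat.add_sub_cancel]
    ring
  · have hc : Tendsto (fun q : E × ℝ => q.1) (𝓝 (u₀, η₀)) (𝓝 u₀) := continuous_fst.tendsto (u₀, η₀)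
    filter_upwards [hc.eventually hq0, hc.eventually hM0] with p h1 h2
    simp only [zero_pow hk1, zero_mul]
    rw [h1, h2, smul_smul, add_comm]
    rfl

/-- A non-degenerate zero `(u₀, η₀)` on the unit sphere of the leading part of the blow-up of `G`
continues to a curve of zeros of `G` tangent to `u₀`. -/
theorem exists_zero_curve {G : E × ℝ → E} (hG : SmoothNear G 0)
    (h0 : ∀ᶠ l in 𝓝 (0 : ℝ), G (0, l) = 0) {a : ℝ}
    (ha : ∀ u, HasDerivAt (fun l => fderiv ℝ (fun y => G (y, l)) 0 u) (a • u) 0) {k : ℕ}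
    (hk : 2 ≤ k) (hlow : ∀ l < k, iteratedFDeriv ℝ l (fun y => G (y, 0)) 0 = 0) {u₀ : E} {η₀ : ℝ}
    (hu₀ : ‖u₀‖ = 1) (hz : (η₀ * a) • u₀ + taylorTerm G k u₀ = 0)
    (hnd : ∀ (v : E) (s : ℝ), inner ℝ u₀ v = 0 →
      fderiv ℝ (fun p : E × ℝ => (p.2 * a) • p.1 + taylorTerm G k p.1) (u₀, η₀) (v, s) = 0 →
      (v, s) = 0) :
    ∃ (u : ℝ → E) (η : ℝ → ℝ),
      (∀ᶠ z in 𝓝 0, DifferentiableAt ℝ u z ∧ DifferentiableAt ℝ η z) ∧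
      ∀ᶠ z in 𝓝 0, ‖u z‖ = 1 ∧ G (z • u z, z ^ (k - 1) * η z) = 0 := by
  obtain ⟨H, hH, hGH, hH0⟩ := exists_smooth_blowUp hG h0 ha hk hlow u₀ η₀
  let Φ : (E × ℝ) × ℝ → (E × ℝ) × ℝ := fun p => ((H p, ‖p.1.1‖ ^ 2), p.2)
  have hn : ContDiff ℝ ∞ fun p : (E × ℝ) × ℝ => ‖p.1.1‖ ^ 2 :=
    (contDiff_fst.comp contDiff_fst).norm_sq ℝ
  have hΦ : SmoothNear Φ ((u₀, η₀), 0) := by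
    filter_upwards [hH] with p hp
    exact (hp.prodMk hn.contDiffAt).prodMk contDiffAt_snd
  have hΦ0 : Φ ((u₀, η₀), 0) = ((0, 1), 0) := by
    have : H ((u₀, η₀), 0) = 0 := hH0.self_of_nhds.trans hz
    simp [Φ, this, hu₀]
  have hinj : ∀ w, fderiv ℝ Φ ((u₀, η₀), 0) w = 0 → w = 0 := by
    rintro ⟨⟨v, s⟩, e⟩ hw
    have d1 := hH.differentiableAt.hasFDerivAt
    have d2 : HasFDerivAt (fun p : (E × ℝ) × ℝ => ‖p.1.1‖ ^ 2) _ ((u₀, η₀), (0 : ℝ)) :=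
      (((ContinuousLinearMap.fst ℝ E ℝ).comp
        (ContinuousLinearMap.fst ℝ (E × ℝ) ℝ)).hasFDerivAt (x := ((u₀, η₀), (0 : ℝ)))).norm_sq
    have d3 := (d1.prodMk d2).prodMk (hasFDerivAt_snd (𝕜 := ℝ) (p := ((u₀, η₀), (0 : ℝ))))
    rw [HasFDerivAt.fderiv (f := Φ) d3] at hw
    have hw' := Prod.ext_iff.1 hw
    have hw1 := Prod.ext_iff.1 hw'.1
    have he : e = 0 := hw'.2
    have hv : inner ℝ u₀ v = 0 := by simpa using hw1.2
    have hv' : fderiv ℝ H ((u₀, η₀), 0) ((v, s), e) = 0 := hw1.1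
    subst he
    have hl : HasFDerivAt (fun q : E × ℝ => (q, (0 : ℝ))) (ContinuousLinearMap.inl ℝ (E × ℝ) ℝ)
        (u₀, η₀) := (ContinuousLinearMap.inl ℝ (E × ℝ) ℝ).hasFDerivAt
    have d4 := (HasFDerivAt.comp (f := fun q : E × ℝ => (q, (0 : ℝ))) (u₀, η₀) d1 hl)
    have d5 := d4.congr_of_eventuallyEq (f₁ :=
      fun p : E × ℝ => (p.2 * a) • p.1 + taylorTerm G k p.1)
      (hH0.mono fun q hq => by simpa using hq.symm)
    have := hnd v s hv (by rw [d5.fderiv]; simpa using hv')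
    simpa using this
  obtain ⟨c, hc0, hcd, hc⟩ := hΦ.exists_local_rightInverse hinj
  rw [hΦ0] at hc0 hcd hc
  have ht : Tendsto (fun z : ℝ => (((0 : E), (1 : ℝ)), z)) (𝓝 0) (𝓝 ((0, 1), 0)) :=
    Continuous.tendsto (f := fun z : ℝ => (((0 : E), (1 : ℝ)), z)) (by fun_prop) 0
  refine ⟨fun z => (c ((0, 1), z)).1.1, fun z => (c ((0, 1), z)).1.2, ?_, ?_⟩
  · filter_upwards [ht.eventually hcd] with z hz
    have : DifferentiableAt ℝ (fun z : ℝ => c ((0, 1), z)) z :=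
      DifferentiableAt.comp (f := fun z : ℝ => (((0 : E), (1 : ℝ)), z)) z hz (by fun_prop)
    exact ⟨this.fst.fst, this.fst.snd⟩
  · have hcc : ContinuousAt c ((0, 1), 0) := hcd.self_of_nhds.continuousAt
    have hcc' : Tendsto c (𝓝 ((0, 1), 0)) (𝓝 ((u₀, η₀), 0)) := by
      have := hcc.tendsto
      rwa [hc0] at this
    filter_upwards [ht.eventually hc, (hcc'.comp ht).eventually hGH] with z h1 h2
    have h3 := Prod.ext_iff.1 h1
    have h4 := Prod.ext_iff.1 h3.1
    have h5 : (c ((0, 1), z)).2 = z := h3.2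
    have h6 : H (c ((0, 1), z)) = 0 := h4.1
    have h7 : ‖(c ((0, 1), z)).1.1‖ ^ 2 = 1 := h4.2
    simp only [Function.comp_apply, h5, h6, smul_zero] at h2
    exact ⟨by nlinarith [norm_nonneg (c ((0, 1), z)).1.1], h2⟩

end BlowUp

/-! ### Even vector fields on the circle -/

/-- On the circle the tangential part of an even vector field, written in the rotating frame, is an
odd function, so that it vanishes somewhere. -/
theorem exists_tangential_zero_of_even
    {Q : EuclideanSpace ℝ (Fin 2) → EuclideanSpace ℝ (Fin 2)} (hQ : Continuous Q)
    (heven : ∀ u, Q (-u) = Q u) : ∃ u, ‖u‖ = 1 ∧ Q u = (inner ℝ (Q u) u : ℝ) • u := by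
  let u : ℝ → EuclideanSpace ℝ (Fin 2) := fun θ => !₂[Real.cos θ, Real.sin θ]
  have hu : Continuous u := by
    refine (PiLp.continuous_toLp 2 _).comp (continuous_pi fun i => ?_)
    fin_cases i
    · exact Real.continuous_cos
    · exact Real.continuous_sin
  let t : ℝ → ℝ := fun θ => Q (u θ) 1 * Real.cos θ - Q (u θ) 0 * Real.sin θ
  have ht : Continuous t := by
    have h : ∀ i, Continuous fun θ => Q (u θ) i := fun i =>
      (EuclideanSpace.proj (𝕜 := ℝ) i).continuous.comp (hQ.comp hu)
    exact ((h 1).mul Real.continuous_cos).sub ((h 0).mul Real.continuous_sin)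
  have hπ : t Real.pi = - t 0 := by
    have : u Real.pi = - u 0 := by
      ext i
      fin_cases i <;> simp [u]
    simp only [t, this, heven]
    simp
  obtain ⟨θ, hθ⟩ : ∃ θ, t θ = 0 := by
    have h0 : (0 : ℝ) ∈ uIcc (t 0) (t Real.pi) := by
      rw [hπ, mem_uIcc]
      rcases le_total (t 0) 0 with h | h
      · left; constructor <;> linarith
      · right; constructor <;> linarith
    obtain ⟨θ, -, hθ⟩ := intermediate_value_uIcc ht.continuousOn h0
    exact ⟨θ, hθ⟩
  have hcs := Real.cos_sq_add_sin_sq θ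
  have hin : (inner ℝ (Q (u θ)) (u θ) : ℝ) =
      Q (u θ) 0 * Real.cos θ + Q (u θ) 1 * Real.sin θ := by
    rw [PiLp.inner_apply, Fin.sum_univ_two]
    simp [u, mul_comm]
  refine ⟨u θ, ?_, ?_⟩
  · rw [EuclideanSpace.norm_eq, Fin.sum_univ_two]
    simp [u]
  · rw [hin]
    simp only [t] at hθ
    ext i
    fin_cases i
    · simp only [u, Fin.zero_eta, PiLp.smul_apply, smul_eq_mul, Matrix.cons_val_zero]
      linear_combination (-Real.sin θ) * hθ - Q (u θ) 0 * hcs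
    · simp only [u, Fin.mk_one, PiLp.smul_apply, smul_eq_mul, Matrix.cons_val_one,
        Matrix.cons_val_fin_one]
      linear_combination (Real.cos θ) * hθ - Q (u θ) 1 * hcs

/-! ### Admissible vector fields and their linearization -/

section CellFunctions

variable {ϑ : ℕ}

/-- By symmetry the partial derivatives in the directions of the inputs agree along the trivial
branch. -/
theorem fderiv_apply_of_symmetric [NeZero ϑ] {f : CellVars ϑ → ℝ} {l : ℝ}
    (hsym : ∀ (σ : Equiv.Perm (Fin ϑ)) (x₀ : ℝ) (x : Fin ϑ → ℝ) (lam : ℝ),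
      f (x₀, x ∘ σ, lam) = f (x₀, x, lam))
    (hf : DifferentiableAt ℝ f (0, 0, l)) (t : ℝ) (w : Fin ϑ → ℝ) :
    fderiv ℝ f (0, 0, l) (t, w, 0) = t * fderiv ℝ f (0, 0, l) (1, 0, 0) +
      (∑ i, w i) * fderiv ℝ f (0, 0, l) (0, Pi.single 0 1, 0) := by
  have hsingle : ∀ i, fderiv ℝ f (0, 0, l) (0, Pi.single i 1, 0) =
      fderiv ℝ f (0, 0, l) (0, Pi.single 0 1, 0) := by
    intro i
    let P : CellVars ϑ →L[ℝ] CellVars ϑ := (ContinuousLinearMap.id ℝ ℝ).prodMap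
      ((ContinuousLinearMap.pi fun j => ContinuousLinearMap.proj (Equiv.swap 0 i j)).prodMap
        (ContinuousLinearMap.id ℝ ℝ))
    have hP : ∀ p, P p = (p.1, p.2.1 ∘ Equiv.swap 0 i, p.2.2) := fun p => rfl
    have hfP : f ∘ P = f := by
      funext p
      rw [Function.comp_apply, hP, hsym]
    have hP0 : P (0, 0, l) = (0, 0, l) := by
      rw [hP]
      rfl
    have h1 : HasFDerivAt (f ∘ P) ((fderiv ℝ f (0, 0, l)).comp P) (0, 0, l) :=
      HasFDerivAt.comp _ (by rw [hP0]; exact hf.hasFDerivAt) P.hasFDerivAt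
    rw [hfP] at h1
    have h2 : P (0, Pi.single 0 1, 0) = (0, Pi.single i 1, 0) := by
      rw [hP]
      refine Prod.ext rfl (Prod.ext ?_ rfl)
      funext j
      simp only [Function.comp_apply, Pi.single_apply]
      congr 1
      rw [Equiv.swap_apply_eq_iff, Equiv.swap_apply_left]
    rw [← h2, ← ContinuousLinearMap.comp_apply, ← h1.fderiv]
  have hdec : ((t, w, 0) : CellVars ϑ) =
      t • (1, 0, 0) + ∑ i, w i • ((0, Pi.single i 1, 0) : CellVars ϑ) := by
    refine Prod.ext ?_ (Prod.ext ?_ ?_)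
    · simp [Prod.fst_sum]
    · funext j
      simp [Prod.fst_sum, Prod.snd_sum, Finset.sum_apply, Pi.single_apply]
    · simp [Prod.snd_sum]
  rw [hdec, map_add, map_smul, map_sum]
  simp only [map_smul, hsingle, smul_eq_mul, Finset.sum_mul]

theorem hasDerivAt_fderiv_apply_lam {f : CellVars ϑ → ℝ} (hf : SmoothNear f 0) (v : CellVars ϑ) :
    HasDerivAt (fun l : ℝ => fderiv ℝ f (0, 0, l) v)
      (iteratedFDeriv ℝ 2 f 0 ![v, (0, 0, 1)]) 0 := by
  have h1 : HasFDerivAt (fderiv ℝ f) (fderiv ℝ (fderiv ℝ f) 0) ((0, 0, 0) : CellVars ϑ) :=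
    hf.fderiv.differentiableAt.hasFDerivAt
  have h2 : HasDerivAt (fun l : ℝ => ((0, 0, l) : CellVars ϑ)) (0, 0, 1) 0 :=
    (hasDerivAt_const _ _).prodMk ((hasDerivAt_const _ _).prodMk (hasDerivAt_id _))
  have h3 : HasDerivAt (fun l : ℝ => fderiv ℝ f (0, 0, l))
      (fderiv ℝ (fderiv ℝ f) 0 (0, 0, 1)) 0 :=
    HasFDerivAt.comp_hasDerivAt (f := fun l : ℝ => ((0, 0, l) : CellVars ϑ)) (0 : ℝ) h1 h2
  have hs : IsSymmSndFDerivAt ℝ f 0 := hf.contDiffAt.isSymmSndFDerivAt (by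
    rw [minSmoothness_of_isRCLikeNormedField]
    exact ENat.LEInfty.out)
  have h4 : iteratedFDeriv ℝ 2 f 0 ![v, (0, 0, 1)] = fderiv ℝ (fderiv ℝ f) 0 (0, 0, 1) v :=
    (iteratedFDeriv_two_apply f 0 _).trans (hs.eq v (0, 0, 1))
  rw [h4]
  exact (ContinuousLinearMap.apply ℝ ℝ v).hasFDerivAt.comp_hasDerivAt (0 : ℝ) h3

end CellFunctions

namespace RegularNetwork

variable {C E : Type*} {ϑ : ℕ}

section Quotient

/-- The input set of a cell of the quotient is the input set of its representative. -/
def quotientInputEquiv (N : RegularNetwork C E ϑ) (r : Setoid C) (q : Quotient r) :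
    {e // (N.quotient r).t e = q} ≃ {e // N.t e = q.out} where
  toFun e := ⟨e.1.1, e.1.2.symm.trans (congrArg Quotient.out e.2)⟩
  invFun e := ⟨⟨e.1, by rw [e.2, Quotient.out_eq]⟩, by
    change Quotient.mk r (N.t e.1) = q
    rw [e.2, Quotient.out_eq]⟩
  left_inv _ := rfl
  right_inv _ := rfl

/-- On the polydiagonal of a balanced coloring the vector field is that of the quotient network. -/
theorem vectorField_comp_mk [Finite E] (N : RegularNetwork C E ϑ) {r : Setoid C}
    (hr : N.IsBalanced r) {f : CellVars ϑ → ℝ}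
    (hsym : ∀ (σ : Equiv.Perm (Fin ϑ)) (x₀ : ℝ) (x : Fin ϑ → ℝ) (lam : ℝ),
      f (x₀, x ∘ σ, lam) = f (x₀, x, lam)) (y : Quotient r → ℝ) (l : ℝ) :
    N.vectorField f (y ∘ Quotient.mk r, l) =
      (N.quotient r).vectorField f (y, l) ∘ Quotient.mk r := by
  funext c
  obtain ⟨β, hβ⟩ := hr c (Quotient.mk r c).out (Quotient.exact (Quotient.out_eq _).symm)
  let σ : Equiv.Perm (Fin ϑ) := (N.inputEquiv c).trans (β.trans
    ((N.quotientInputEquiv r (Quotient.mk r c)).symm.trans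
      ((N.quotient r).inputEquiv (Quotient.mk r c)).symm))
  have h : ∀ i, Quotient.mk r (N.s (N.inputEquiv c i).1) =
      (N.quotient r).s ((N.quotient r).inputEquiv (Quotient.mk r c) (σ i)).1 := by
    intro i
    simp only [σ, Equiv.trans_apply, Equiv.apply_symm_apply]
    exact Quotient.sound (hβ _)
  refine Eq.trans ?_ (hsym σ _ _ _)
  simp only [vectorField, Function.comp_def, h]

end Quotient

theorem vectorField_zero [Finite E] [NeZero ϑ] (N : RegularNetwork C E ϑ) {μ : ℝ}
    {f : CellVars ϑ → ℝ}
    (hf : HasBifurcationCondition μ f) (l : ℝ) : N.vectorField f (0, l) = 0 :=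
  funext fun _ => hf.trivial_zero l

section Linearization

variable [Finite E]

/-- The adjacency matrix adds up the states of the sources of the input edges. -/
theorem adjacencyEnd_apply [Fintype C] (N : RegularNetwork C E ϑ) (z : C → ℝ) (c : C) :
    N.adjacencyEnd z c = ∑ i, z (N.s (N.inputEquiv c i).1) := by
  classical
  have := Fintype.ofFinite E
  have h1 : ∀ c', (Nat.card {e // N.s e = c' ∧ N.t e = c} : ℝ) =
      ∑ e : {e // N.t e = c}, if N.s e.1 = c' then (1 : ℝ) else 0 := by
    intro c'
    rw [Finset.sum_boole, ← Fintype.card_subtype, ← Nat.card_eq_fintype_card]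
    congr 1
    refine Nat.card_congr ⟨fun e => ⟨⟨e.1, e.2.2⟩, e.2.1⟩, fun e => ⟨e.1.1, e.2, e.1.2⟩,
      fun _ => rfl, fun _ => rfl⟩
  change (N.adjacency.mulVec z) c = _
  simp only [Matrix.mulVec, dotProduct, adjacency, Matrix.of_apply, h1, Finset.sum_mul]
  rw [Finset.sum_comm, Equiv.sum_comp (N.inputEquiv c) fun e => z (N.s e.1)]
  refine Finset.sum_congr rfl fun e _ => ?_
  simp

/-- The input variables of the cell `c`, as a linear function of the state of the network. -/
noncomputable def cellInput (N : RegularNetwork C E ϑ) (c : C) :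
    (C → ℝ) × ℝ →L[ℝ] CellVars ϑ :=
  ((ContinuousLinearMap.proj c).comp (ContinuousLinearMap.fst ℝ (C → ℝ) ℝ)).prod
    (((ContinuousLinearMap.pi fun i => ContinuousLinearMap.proj (N.s (N.inputEquiv c i).1)).comp
      (ContinuousLinearMap.fst ℝ (C → ℝ) ℝ)).prod (ContinuousLinearMap.snd ℝ (C → ℝ) ℝ))

theorem smoothNear_vectorField [Fintype C] (N : RegularNetwork C E ϑ) {f : CellVars ϑ → ℝ}
    (hf : SmoothNear f 0) : SmoothNear (N.vectorField f) 0 := by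
  have h : ∀ c, SmoothNear (fun p => f (N.cellInput c p)) 0 := fun c =>
    SmoothNear.comp (by simpa using hf) ((N.cellInput c).contDiff.smoothNear 0)
  filter_upwards [eventually_all.2 h] with p hp
  exact contDiffAt_pi.2 hp

theorem fderiv_vectorField [Fintype C] [NeZero ϑ] (N : RegularNetwork C E ϑ)
    {f : CellVars ϑ → ℝ} {l : ℝ}
    (hsym : ∀ (σ : Equiv.Perm (Fin ϑ)) (x₀ : ℝ) (x : Fin ϑ → ℝ) (lam : ℝ),
      f (x₀, x ∘ σ, lam) = f (x₀, x, lam))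
    (hf : DifferentiableAt ℝ f (0, 0, l)) (z : C → ℝ) :
    fderiv ℝ (fun x => N.vectorField f (x, l)) 0 z =
      fderiv ℝ f (0, 0, l) (1, 0, 0) • z +
        fderiv ℝ f (0, 0, l) (0, Pi.single 0 1, 0) • N.adjacencyEnd z := by
  have h1 : ∀ c, HasFDerivAt (fun x : C → ℝ => f (N.cellInput c (x, l)))
      ((fderiv ℝ f (0, 0, l)).comp ((N.cellInput c).comp (ContinuousLinearMap.inl ℝ _ _))) 0 := by
    intro c
    have h2 : HasFDerivAt (fun x : C → ℝ => (x, l)) (ContinuousLinearMap.inl ℝ (C → ℝ) ℝ) 0 :=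
      hasFDerivAt_prodMk_left 0 l
    have h3 : HasFDerivAt f (fderiv ℝ f (0, 0, l)) (N.cellInput c ((0 : C → ℝ), l)) :=
      hf.hasFDerivAt
    have h4 : HasFDerivAt (fun x : C → ℝ => N.cellInput c (x, l))
        ((N.cellInput c).comp (ContinuousLinearMap.inl ℝ _ _)) 0 :=
      HasFDerivAt.comp (f := fun x : C → ℝ => (x, l)) 0 (N.cellInput c).hasFDerivAt h2
    exact HasFDerivAt.comp (f := fun x : C → ℝ => N.cellInput c (x, l)) 0 h3 h4
  have h4 : HasFDerivAt (fun x => N.vectorField f (x, l)) (ContinuousLinearMap.pi fun c =>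
      (fderiv ℝ f (0, 0, l)).comp ((N.cellInput c).comp (ContinuousLinearMap.inl ℝ _ _))) 0 :=
    hasFDerivAt_pi.2 h1
  rw [h4.fderiv]
  funext c
  refine (fderiv_apply_of_symmetric hsym hf (z c)
    (fun i => z (N.s (N.inputEquiv c i).1))).trans ?_
  rw [Pi.add_apply, Pi.smul_apply, Pi.smul_apply, adjacencyEnd_apply, smul_eq_mul, smul_eq_mul,
    mul_comm (z c), mul_comm (∑ i, _)]

theorem jacobian_vectorField [Fintype C] [NeZero ϑ] (N : RegularNetwork C E ϑ) {μ : ℝ}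
    {f : CellVars ϑ → ℝ}
    (hf : HasBifurcationCondition μ f) (z : C → ℝ) :
    jacobian (N.vectorField f) z = coeff1 f • (N.adjacencyEnd z - μ • z) := by
  have h := N.fderiv_vectorField (l := 0) hf.symmetric
    (SmoothNear.differentiableAt (x := (0 : CellVars ϑ)) hf.smooth) z
  have h0 : coeff0 f = -μ * coeff1 f := by linarith [hf.critical]
  refine h.trans ?_
  change coeff0 f • z + coeff1 f • N.adjacencyEnd z = _
  rw [h0]
  module

theorem jacobian_vectorField_injective [Fintype C] [NeZero ϑ] (N : RegularNetwork C E ϑ) {μ : ℝ}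
    {f : CellVars ϑ → ℝ} (hf : HasBifurcationCondition μ f) (hμ : ¬ N.IsEigenvalue μ) :
    LinearMap.ker (jacobian (N.vectorField f)) = ⊥ := by
  rw [LinearMap.ker_eq_bot']
  intro z hz
  rw [N.jacobian_vectorField hf, smul_eq_zero_iff_right hf.coeff1_ne_zero, sub_eq_zero] at hz
  by_contra hne
  exact hμ (Module.End.hasEigenvalue_of_hasEigenvector
    ⟨Module.End.mem_eigenspace_iff.2 hz, hne⟩)

end Linearization

end RegularNetwork

/-! ### Lyapunov-Schmidt reduction -/

section LocalUniqueness

variable {C : Type*} [Fintype C] {F : (C → ℝ) × ℝ → C → ℝ}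

theorem jacobian_apply (hF : DifferentiableAt ℝ F 0) (x : C → ℝ) :
    jacobian F x = fderiv ℝ F 0 (x, 0) := by
  have h1 : HasFDerivAt F (fderiv ℝ F 0) ((0 : C → ℝ), (0 : ℝ)) := hF.hasFDerivAt
  have h2 := HasFDerivAt.comp (f := fun x : C → ℝ => (x, (0 : ℝ))) 0 h1
    (ContinuousLinearMap.inl ℝ (C → ℝ) ℝ).hasFDerivAt
  have h3 : fderiv ℝ (fun x => F (x, 0)) 0 = _ := h2.fderiv
  change fderiv ℝ (fun x => F (x, 0)) 0 x = _
  rw [h3]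
  rfl

/-- Near the origin, the trivial solution is the only solution orthogonal to the kernel of the
Jacobian of the projection of `F = 0` onto the range of the Jacobian. -/
theorem eventually_eq_zero_of_orthogonal (hF : SmoothNear F 0) (hF0 : ∀ l, F (0, l) = 0) :
    ∀ᶠ p in 𝓝 (0 : (C → ℝ) × ℝ), (∀ x ∈ LinearMap.ker (jacobian F), x ⬝ᵥ p.1 = 0) →
      jacobian F p.1 ⬝ᵥ F p = 0 → p.1 = 0 := by
  let K : Submodule ℝ (C → ℝ) :=
    { carrier := {w | ∀ x ∈ LinearMap.ker (jacobian F), x ⬝ᵥ w = 0}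
      add_mem' := fun ha hb x hx => by rw [dotProduct_add, ha x hx, hb x hx, add_zero]
      zero_mem' := fun x _ => dotProduct_zero x
      smul_mem' := fun c w hw x hx => by rw [dotProduct_smul, hw x hx, smul_zero] }
  have hker : LinearMap.ker ((jacobian F).domRestrict K) = ⊥ := by
    rw [LinearMap.ker_eq_bot']
    intro w hw
    exact Subtype.ext (dotProduct_self_eq_zero.1 (w.2 w.1 hw))
  obtain ⟨c, -, hc⟩ := LinearMap.exists_antilipschitzWith _ hker
  have hc' : ∀ w ∈ K, ‖w‖ ≤ c * ‖jacobian F w‖ := fun w hw => by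
    have := hc.le_mul_dist ⟨w, hw⟩ 0
    simpa using this
  have hself : ∀ v : C → ℝ, ‖v‖ ^ 2 ≤ v ⬝ᵥ v := by
    intro v
    have h1 : ∀ i, v i * v i ≤ v ⬝ᵥ v := fun i =>
      Finset.single_le_sum (f := fun i => v i * v i) (fun i _ => mul_self_nonneg _)
        (Finset.mem_univ i)
    have h0 : 0 ≤ v ⬝ᵥ v := Finset.sum_nonneg fun i _ => mul_self_nonneg (v i)
    refine Real.le_sqrt (norm_nonneg _) h0 |>.1 ?_
    refine (pi_norm_le_iff_of_nonneg (Real.sqrt_nonneg _)).2 fun i => ?_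
    rw [Real.norm_eq_abs, ← Real.sqrt_mul_self_eq_abs]
    exact Real.sqrt_le_sqrt (h1 i)
  have hcs : ∀ v w : C → ℝ, |v ⬝ᵥ w| ≤ Fintype.card C * (‖v‖ * ‖w‖) := by
    intro v w
    refine (Finset.abs_sum_le_sum_abs _ _).trans ?_
    rw [← nsmul_eq_mul, ← Finset.card_univ]
    refine Finset.sum_le_card_nsmul _ _ _ fun i _ => ?_
    rw [abs_mul]
    exact mul_le_mul (norm_le_pi_norm v i) (norm_le_pi_norm w i) (abs_nonneg _) (norm_nonneg _)
  -- the factor for which the estimate below is contracting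
  set δ : ℝ := 1 / (2 * (c * Fintype.card C + 1)) with hδ
  have hcn : (0 : ℝ) ≤ c * Fintype.card C := by positivity
  have hδ0 : 0 < δ := by positivity
  have hstrict := (hF.contDiffAt.hasStrictFDerivAt (by simp)).isLittleO.def hδ0
  have ht : Tendsto (fun p : (C → ℝ) × ℝ => (p, ((0 : C → ℝ), p.2))) (𝓝 0) (𝓝 (0, 0)) :=
    Continuous.tendsto (f := fun p : (C → ℝ) × ℝ => (p, ((0 : C → ℝ), p.2))) (by fun_prop) 0
  filter_upwards [ht.eventually hstrict] with p hp hK hJ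
  have hsub : p - (0, p.2) = (p.1, 0) := by ext <;> simp
  simp only [hF0, sub_zero, hsub] at hp
  rw [← jacobian_apply hF.differentiableAt] at hp
  have hn : ‖((p.1, 0) : (C → ℝ) × ℝ)‖ = ‖p.1‖ := by simp
  rw [hn] at hp
  set v := jacobian F p.1 with hv
  have h1 : v ⬝ᵥ v = - (v ⬝ᵥ (F p - v)) := by
    rw [dotProduct_sub, hJ]
    ring
  have h2 : ‖v‖ ^ 2 ≤ Fintype.card C * (‖v‖ * (δ * ‖p.1‖)) := by
    calc ‖v‖ ^ 2 ≤ v ⬝ᵥ v := hself v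
      _ ≤ |v ⬝ᵥ (F p - v)| := by rw [h1]; exact neg_le_abs _
      _ ≤ Fintype.card C * (‖v‖ * ‖F p - v‖) := hcs _ _
      _ ≤ _ := by gcongr
  have h3 : ‖v‖ ≤ Fintype.card C * (δ * ‖p.1‖) := by
    rcases (norm_nonneg v).eq_or_lt with h | h
    · rw [← h]
      positivity
    · refine le_of_mul_le_mul_left ?_ h
      linarith
  have h4 : ‖p.1‖ ≤ c * (Fintype.card C * (δ * ‖p.1‖)) :=
    (hc' p.1 hK).trans (by gcongr)
  have h5 : c * Fintype.card C * δ ≤ 1 / 2 := by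
    rw [hδ, mul_one_div, div_le_div_iff₀ (by positivity) (by norm_num)]
    linarith
  have h6 : ‖p.1‖ ≤ 1 / 2 * ‖p.1‖ := by
    calc ‖p.1‖ ≤ c * Fintype.card C * δ * ‖p.1‖ := by linarith
      _ ≤ _ := by gcongr
  exact norm_le_zero_iff.1 (by linarith)

end LocalUniqueness

namespace LyapunovSchmidt

variable {C : Type*} [Fintype C] {F : (C → ℝ) × ℝ → C → ℝ} {m : ℕ}

/-- The parametrization `y ↦ ∑ y_i v_i` of the kernel of the Jacobian. -/
noncomputable def embed (R : LyapunovSchmidt F m) : EuclideanSpace ℝ (Fin m) →L[ℝ] (C → ℝ) :=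
  ∑ j, (EuclideanSpace.proj j : EuclideanSpace ℝ (Fin m) →L[ℝ] ℝ).smulRight (R.v j : C → ℝ)

/-- The map `x ↦ (⟨w_i, x⟩)_i`, whose kernel is the range of the Jacobian. -/
noncomputable def coords (R : LyapunovSchmidt F m) : (C → ℝ) →L[ℝ] EuclideanSpace ℝ (Fin m) :=
  LinearMap.toContinuousLinearMap
    { toFun := fun x => WithLp.toLp 2 fun i => R.w i ⬝ᵥ x
      map_add' := fun x y => by ext i; simp [dotProduct_add]
      map_smul' := fun c x => by ext i; simp [dotProduct_smul] }

theorem embed_apply (R : LyapunovSchmidt F m) (y : EuclideanSpace ℝ (Fin m)) :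
    R.embed y = ∑ j, y j • (R.v j : C → ℝ) := by
  simp [embed]

theorem coords_apply (R : LyapunovSchmidt F m) (x : C → ℝ) (i : Fin m) :
    R.coords x i = R.w i ⬝ᵥ x := rfl

theorem g_eq (R : LyapunovSchmidt F m) (p : EuclideanSpace ℝ (Fin m) × ℝ) :
    R.g p = R.coords (F (R.embed p.1 + R.W p, p.2)) := by
  rw [embed_apply]
  rfl

theorem coords_embed (R : LyapunovSchmidt F m) (y : EuclideanSpace ℝ (Fin m)) :
    R.coords (R.embed y) = y := by
  ext i
  rw [coords_apply, embed_apply, dotProduct_sum]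
  simp [dotProduct_smul, R.w_dual]

theorem embed_mem_ker (R : LyapunovSchmidt F m) (y : EuclideanSpace ℝ (Fin m)) :
    R.embed y ∈ LinearMap.ker (jacobian F) := by
  rw [embed_apply]
  exact Submodule.sum_mem _ fun j _ => Submodule.smul_mem _ _ (R.v j).2

theorem eq_finrank (R : LyapunovSchmidt F m) :
    m = Module.finrank ℝ (LinearMap.ker (jacobian F)) := by
  rw [Module.finrank_eq_card_basis R.v, Fintype.card_fin]

/-- The vectors `w_i` span the orthogonal complement of the range of the Jacobian, by a dimension
count. -/
theorem eq_zero_of_coords_eq_zero (R : LyapunovSchmidt F m) {x : C → ℝ} (hx : R.coords x = 0)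
    (hJ : ∀ z, jacobian F z ⬝ᵥ x = 0) : x = 0 := by
  have hle : LinearMap.range (jacobian F) ≤
      LinearMap.ker (R.coords : (C → ℝ) →ₗ[ℝ] EuclideanSpace ℝ (Fin m)) := by
    rintro _ ⟨z, rfl⟩
    rw [LinearMap.mem_ker]
    ext i
    exact R.w_orth i z
  have hsurj : LinearMap.range (R.coords : (C → ℝ) →ₗ[ℝ] EuclideanSpace ℝ (Fin m)) = ⊤ :=
    LinearMap.range_eq_top.2 fun y => ⟨R.embed y, R.coords_embed y⟩
  have h1 := LinearMap.finrank_range_add_finrank_ker (jacobian F)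
  have h2 := LinearMap.finrank_range_add_finrank_ker
    (R.coords : (C → ℝ) →ₗ[ℝ] EuclideanSpace ℝ (Fin m))
  rw [hsurj, finrank_top, finrank_euclideanSpace_fin] at h2
  have h3 := R.eq_finrank
  have heq := Submodule.eq_of_le_of_finrank_eq hle (by omega)
  have hmem : x ∈ LinearMap.range (jacobian F) := by
    rw [heq]
    exact hx
  obtain ⟨z, rfl⟩ := hmem
  exact dotProduct_self_eq_zero.1 (hJ z)

theorem smoothNear_g (R : LyapunovSchmidt F m) (hF : SmoothNear F 0) : SmoothNear R.g 0 := by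
  have h1 : SmoothNear (fun p : EuclideanSpace ℝ (Fin m) × ℝ => (R.embed p.1 + R.W p, p.2)) 0 := by
    filter_upwards [R.W_smooth] with p hp
    exact ((R.embed.contDiff.comp contDiff_fst).contDiffAt.add hp).prodMk contDiffAt_snd
  have h2 := SmoothNear.comp (g := F) (by simpa [R.W_zero, ← Prod.zero_eq_mk] using hF) h1
  have h3 : R.g = fun p => R.coords (F (R.embed p.1 + R.W p, p.2)) := funext R.g_eq
  rw [h3]
  exact SmoothNear.comp (R.coords.contDiff.smoothNear _) h2

theorem eventually_solution_of_g_eq_zero (R : LyapunovSchmidt F m) :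
    ∀ᶠ p in 𝓝 (0 : EuclideanSpace ℝ (Fin m) × ℝ), R.g p = 0 →
      F (R.embed p.1 + R.W p, p.2) = 0 := by
  filter_upwards [R.W_solves] with p hp hg
  rw [g_eq] at hg
  refine R.eq_zero_of_coords_eq_zero hg fun z => ?_
  rw [embed_apply]
  exact hp z

theorem eventually_embed_add_ne_zero (R : LyapunovSchmidt F m) :
    ∀ᶠ p in 𝓝 (0 : EuclideanSpace ℝ (Fin m) × ℝ), p.1 ≠ 0 → R.embed p.1 + R.W p ≠ 0 := by
  filter_upwards [R.W_orth] with p hp hne h0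
  have h1 := hp _ (R.embed_mem_ker p.1)
  have h2 : R.W p = - R.embed p.1 := (neg_eq_of_add_eq_zero_right h0).symm
  rw [h2, dotProduct_neg, neg_eq_zero, dotProduct_self_eq_zero] at h1
  apply hne
  rw [← R.coords_embed p.1, h1, map_zero]

theorem eventually_W_zero_eq_zero (R : LyapunovSchmidt F m) (hF : SmoothNear F 0)
    (hF0 : ∀ l, F (0, l) = 0) : ∀ᶠ l in 𝓝 (0 : ℝ), R.W (0, l) = 0 := by
  have h1 : Tendsto (fun l : ℝ => ((0 : EuclideanSpace ℝ (Fin m)), l)) (𝓝 0) (𝓝 0) :=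
    Continuous.tendsto (f := fun l : ℝ => ((0 : EuclideanSpace ℝ (Fin m)), l)) (by fun_prop) 0
  have hW : Tendsto R.W (𝓝 0) (𝓝 0) := by
    simpa [R.W_zero] using (SmoothNear.continuousAt R.W_smooth).tendsto
  have h2 : Tendsto (fun l : ℝ => (R.W (0, l), l)) (𝓝 0) (𝓝 0) :=
    (hW.comp h1).prodMk_nhds tendsto_id
  filter_upwards [h2.eventually (eventually_eq_zero_of_orthogonal hF hF0),
    h1.eventually R.W_orth, h1.eventually R.W_solves] with l h3 h4 h5
  refine h3 h4 ?_
  have := h5 (R.W (0, l))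
  simpa using this

/-- The implicit function is tangent to the kernel of the Jacobian. -/
theorem fderiv_W_apply (R : LyapunovSchmidt F m) (hF : SmoothNear F 0)
    (u : EuclideanSpace ℝ (Fin m)) : fderiv ℝ R.W 0 (u, 0) = 0 := by
  have hW : DifferentiableAt ℝ R.W ((0 : EuclideanSpace ℝ (Fin m)), (0 : ℝ)) :=
    SmoothNear.differentiableAt R.W_smooth
  have hc : HasDerivAt (fun s : ℝ => ((s • u, 0) : EuclideanSpace ℝ (Fin m) × ℝ)) (u, 0) 0 := by
    have h1 : HasDerivAt (fun s : ℝ => s • u) u 0 := by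
      simpa using (hasDerivAt_id (0 : ℝ)).smul_const u
    exact h1.prodMk (hasDerivAt_const _ _)
  have hW' : HasFDerivAt R.W (fderiv ℝ R.W 0)
      (((0 : ℝ) • u, 0) : EuclideanSpace ℝ (Fin m) × ℝ) := by
    rw [zero_smul]
    exact hW.hasFDerivAt
  have hWc : HasDerivAt (fun s : ℝ => R.W (s • u, 0)) (fderiv ℝ R.W 0 (u, 0)) 0 :=
    HasFDerivAt.comp_hasDerivAt (f := fun s : ℝ => ((s • u, 0) : EuclideanSpace ℝ (Fin m) × ℝ))
      (0 : ℝ) hW' hc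
  have ht : Tendsto (fun s : ℝ => ((s • u, 0) : EuclideanSpace ℝ (Fin m) × ℝ)) (𝓝 0) (𝓝 0) := by
    simpa [← Prod.zero_eq_mk] using hc.continuousAt.tendsto
  set d := fderiv ℝ R.W 0 (u, 0) with hd
  have hdot : ∀ (z : C → ℝ) (G : ℝ → C → ℝ) (G' : C → ℝ), HasDerivAt G G' 0 →
      (∀ᶠ s in 𝓝 0, z ⬝ᵥ G s = 0) → z ⬝ᵥ G' = 0 := by
    intro z G G' hG h0
    have h1 : HasDerivAt (fun s => z ⬝ᵥ G s) (z ⬝ᵥ G') 0 :=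
      HasDerivAt.fun_sum fun i _ => ((hasDerivAt_pi.1 hG) i).const_mul (z i)
    exact h1.unique ((hasDerivAt_const (0 : ℝ) (0 : ℝ)).congr_of_eventuallyEq h0)
  have h1 : ∀ x ∈ LinearMap.ker (jacobian F), x ⬝ᵥ d = 0 := fun x hx =>
    hdot x _ d hWc ((ht.eventually R.W_orth).mono fun s hs => hs x hx)
  have h2 : HasDerivAt (fun s : ℝ => F (R.embed (s • u) + R.W (s • u, 0), 0))
      (fderiv ℝ F 0 (R.embed u + d, 0)) 0 := by
    have h3 : HasDerivAt (fun s : ℝ => R.embed (s • u)) (R.embed u) 0 := by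
      simpa using (hasDerivAt_id (0 : ℝ)).smul_const (R.embed u)
    have h4 : HasDerivAt (fun s : ℝ => ((R.embed (s • u) + R.W (s • u, 0), 0) : (C → ℝ) × ℝ))
        (R.embed u + d, 0) 0 := (h3.add hWc).prodMk (hasDerivAt_const _ _)
    refine HasFDerivAt.comp_hasDerivAt
      (f := fun s : ℝ => ((R.embed (s • u) + R.W (s • u, 0), 0) : (C → ℝ) × ℝ)) (0 : ℝ) ?_ h4
    have h5 : ((R.embed ((0 : ℝ) • u) + R.W ((0 : ℝ) • u, 0), 0) : (C → ℝ) × ℝ) = 0 := by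
      simp [← Prod.zero_eq_mk, R.W_zero]
    rw [h5]
    exact hF.differentiableAt.hasFDerivAt
  have h3 : jacobian F d = 0 := by
    have h4 : jacobian F d ⬝ᵥ fderiv ℝ F 0 (R.embed u + d, 0) = 0 := by
      refine hdot _ _ _ h2 ((ht.eventually R.W_solves).mono fun s hs => ?_)
      rw [embed_apply]
      exact hs d
    rw [← jacobian_apply hF.differentiableAt, map_add,
      LinearMap.mem_ker.1 (R.embed_mem_ker u), zero_add] at h4
    exact dotProduct_self_eq_zero.1 h4
  exact dotProduct_self_eq_zero.1 (h1 d h3)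

/-- If the functionals `w_i` are left eigenvectors of the linearizations along the trivial branch,
for the eigenvalue `σ lam`, then the mixed derivative of `g` at the origin is `σ' 0` times the
identity. -/
theorem hasDerivAt_fderiv_g (R : LyapunovSchmidt F m) (hF : SmoothNear F 0)
    (hF0 : ∀ l, F (0, l) = 0) {σ : ℝ → ℝ} {a : ℝ} (hσ : HasDerivAt σ a 0) (hσ0 : σ 0 = 0)
    (hw : ∀ᶠ l in 𝓝 0, ∀ i z,
      R.w i ⬝ᵥ fderiv ℝ (fun x => F (x, l)) 0 z = σ l * (R.w i ⬝ᵥ z))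
    (u : EuclideanSpace ℝ (Fin m)) :
    HasDerivAt (fun l => fderiv ℝ (fun y => R.g (y, l)) 0 u) (a • u) 0 := by
  have ht : Tendsto (fun l : ℝ => ((0 : EuclideanSpace ℝ (Fin m)), l)) (𝓝 0) (𝓝 0) :=
    Continuous.tendsto (f := fun l : ℝ => ((0 : EuclideanSpace ℝ (Fin m)), l)) (by fun_prop) 0
  have ht' : Tendsto (fun l : ℝ => ((0 : C → ℝ), l)) (𝓝 0) (𝓝 0) :=
    Continuous.tendsto (f := fun l : ℝ => ((0 : C → ℝ), l)) (by fun_prop) 0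
  have hg : (fun l => fderiv ℝ (fun y => R.g (y, l)) 0 u) =ᶠ[𝓝 0]
      fun l => σ l • (u + R.coords (fderiv ℝ R.W (0, l) (u, 0))) := by
    filter_upwards [ht.eventually R.W_smooth, ht'.eventually hF, R.eventually_W_zero_eq_zero hF hF0,
      hw] with l h1 h2 h3 h4
    have d1 : HasFDerivAt (fun y : EuclideanSpace ℝ (Fin m) => R.W (y, l))
        ((fderiv ℝ R.W (0, l)).comp (ContinuousLinearMap.inl ℝ _ _)) 0 :=
      HasFDerivAt.comp (f := fun y : EuclideanSpace ℝ (Fin m) => (y, l)) 0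
        (h1.differentiableAt (by simp)).hasFDerivAt (hasFDerivAt_prodMk_left 0 l)
    have d2 := R.embed.hasFDerivAt (x := 0).add d1
    have d3 : DifferentiableAt ℝ (fun x => F (x, l)) 0 :=
      DifferentiableAt.comp (f := fun x : C → ℝ => (x, l)) 0 (h2.differentiableAt (by simp))
        (by fun_prop)
    have h5 : R.embed 0 + R.W (0, l) = 0 := by simp [h3]
    have d4 : HasFDerivAt (fun x => F (x, l)) (fderiv ℝ (fun x => F (x, l)) 0)
        (R.embed 0 + R.W (0, l)) := h5 ▸ d3.hasFDerivAt
    have d5 : HasFDerivAt (fun y => R.g (y, l)) _ 0 :=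
      ((R.coords.hasFDerivAt.comp _ (HasFDerivAt.comp
        (f := fun y : EuclideanSpace ℝ (Fin m) => R.embed y + R.W (y, l)) 0 d4
        d2))).congr_of_eventuallyEq (Eventually.of_forall fun y => R.g_eq (y, l))
    rw [d5.fderiv]
    have h6 : ∀ z, R.coords (fderiv ℝ (fun x => F (x, l)) 0 z) = σ l • R.coords z := by
      intro z
      ext i
      exact h4 i z
    refine (h6 _).trans ?_
    congr 1
    refine (map_add R.coords _ _).trans ?_
    exact congrArg (· + _) (R.coords_embed u)
  have hW : DifferentiableAt ℝ (fun l : ℝ => fderiv ℝ R.W (0, l)) 0 :=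
    DifferentiableAt.comp (f := fun l : ℝ => ((0 : EuclideanSpace ℝ (Fin m)), l)) 0
      (SmoothNear.fderiv R.W_smooth).differentiableAt (by fun_prop)
  have hc : DifferentiableAt ℝ
      (fun l : ℝ => u + R.coords (fderiv ℝ R.W (0, l) (u, 0))) 0 :=
    (R.coords.differentiableAt.comp (0 : ℝ)
      (hW.clm_apply (differentiableAt_const _))).const_add u
  have h7 := (hσ.smul hc.hasDerivAt).congr_of_eventuallyEq hg
  have h8 : fderiv ℝ R.W ((0 : EuclideanSpace ℝ (Fin m)), (0 : ℝ)) (u, 0) = 0 :=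
    R.fderiv_W_apply hF u
  rw [hσ0, h8] at h7
  simpa using h7

end LyapunovSchmidt

/-! ### Genericity of the crossing speed -/

section Generic

variable {ϑ : ℕ}

/-- The function `lam * x₀`, used to perturb the mixed second derivative at the origin. -/
def lamMulSelf (ϑ : ℕ) : CellVars ϑ → ℝ := fun p => p.2.2 * p.1

theorem contDiff_lamMulSelf : ContDiff ℝ ∞ (lamMulSelf ϑ) := by
  unfold lamMulSelf
  fun_prop

theorem fderiv_lamMulSelf (p v : CellVars ϑ) :
    fderiv ℝ (lamMulSelf ϑ) p v = p.2.2 * v.1 + p.1 * v.2.2 := by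
  have h1 : HasFDerivAt (fun p : CellVars ϑ => p.2.2)
      ((ContinuousLinearMap.snd ℝ (Fin ϑ → ℝ) ℝ).comp (ContinuousLinearMap.snd ℝ ℝ _)) p :=
    ((ContinuousLinearMap.snd ℝ (Fin ϑ → ℝ) ℝ).comp (ContinuousLinearMap.snd ℝ ℝ _)).hasFDerivAt
  have h2 : HasFDerivAt (fun p : CellVars ϑ => p.1) (ContinuousLinearMap.fst ℝ ℝ _) p :=
    hasFDerivAt_fst
  have h3 : HasFDerivAt (lamMulSelf ϑ) _ p := h1.mul h2
  rw [h3.fderiv]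
  simp

theorem iteratedFDeriv_add_smul_lamMulSelf {f : CellVars ϑ → ℝ} (hf : SmoothNear f 0) (e : ℝ)
    (n : ℕ) : iteratedFDeriv ℝ n (f + e • lamMulSelf ϑ) 0 =
      iteratedFDeriv ℝ n f 0 + e • iteratedFDeriv ℝ n (lamMulSelf ϑ) 0 := by
  have h1 : ContDiffAt ℝ n f 0 := hf.contDiffAt.of_le (by exact_mod_cast le_top)
  have h2 : ContDiffAt ℝ n (lamMulSelf ϑ) 0 :=
    contDiff_lamMulSelf.contDiffAt.of_le (by exact_mod_cast le_top)
  have h3 : ContDiffAt ℝ n (e • lamMulSelf ϑ) 0 := h2.const_smul e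
  rw [iteratedFDeriv_add_apply h1 h3, iteratedFDeriv_const_smul_apply h2]

theorem fderiv_add_smul_lamMulSelf {f : CellVars ϑ → ℝ} (hf : SmoothNear f 0) (e : ℝ)
    (v : CellVars ϑ) : fderiv ℝ (f + e • lamMulSelf ϑ) 0 v = fderiv ℝ f 0 v := by
  have h : DifferentiableAt ℝ (lamMulSelf ϑ) 0 := contDiff_lamMulSelf.differentiable (by simp) 0
  rw [fderiv_add hf.differentiableAt (h.const_smul e), fderiv_const_smul h]
  simp [fderiv_lamMulSelf]

theorem HasBifurcationCondition.add_smul_lamMulSelf [NeZero ϑ] {μ : ℝ} {f : CellVars ϑ → ℝ}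
    (hf : HasBifurcationCondition μ f) (e : ℝ) :
    HasBifurcationCondition μ (f + e • lamMulSelf ϑ) where
  symmetric σ x₀ x lam := by simp [lamMulSelf, hf.symmetric σ x₀ x lam]
  smooth := hf.smooth.mono fun p hp => hp.add (contDiff_lamMulSelf.contDiffAt.const_smul e)
  trivial_zero lam := by simp [lamMulSelf, hf.trivial_zero lam]
  critical := by
    rw [coeff0, coeff1, fderiv_add_smul_lamMulSelf hf.smooth, fderiv_add_smul_lamMulSelf hf.smooth]
    exact hf.critical
  coeff1_ne_zero := by
    rw [coeff1, fderiv_add_smul_lamMulSelf hf.smooth]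
    exact hf.coeff1_ne_zero

/-- The derivative at the origin of the critical eigenvalue along the trivial branch. -/
noncomputable def crossingSpeed [NeZero ϑ] (μ : ℝ) (f : CellVars ϑ → ℝ) : ℝ :=
  coeff0Lam f + μ * coeff1Lam f

theorem crossingSpeed_add_smul_lamMulSelf [NeZero ϑ] (μ : ℝ) {f : CellVars ϑ → ℝ}
    (hf : SmoothNear f 0) (e : ℝ) :
    crossingSpeed μ (f + e • lamMulSelf ϑ) = crossingSpeed μ f + e := by
  have hs := (contDiff_lamMulSelf (ϑ := ϑ)).smoothNear 0
  have h0 : iteratedFDeriv ℝ 2 (lamMulSelf ϑ) 0 ![(1, 0, 0), (0, 0, 1)] = 1 := by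
    have h := hasDerivAt_fderiv_apply_lam hs (1, 0, 0)
    simp only [fderiv_lamMulSelf, mul_one, mul_zero, add_zero] at h
    exact h.unique (hasDerivAt_id 0)
  have h1 : iteratedFDeriv ℝ 2 (lamMulSelf ϑ) 0 ![(0, Pi.single 0 1, 0), (0, 0, 1)] = 0 := by
    have h := hasDerivAt_fderiv_apply_lam hs (0, Pi.single 0 1, 0)
    simp only [fderiv_lamMulSelf, mul_zero, add_zero] at h
    exact h.unique (hasDerivAt_const 0 0)
  simp only [crossingSpeed, coeff0Lam, coeff1Lam, iteratedFDeriv_add_smul_lamMulSelf hf,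
    add_apply, smul_apply, h0, h1]
  simp only [smul_eq_mul]
  ring

theorem continuous_crossingSpeed [NeZero ϑ] (μ : ℝ) :
    Continuous[jetTopology ϑ, inferInstance] (crossingSpeed (ϑ := ϑ) μ) := by
  let _ := jetTopology ϑ
  have hjet : Continuous fun (f : CellVars ϑ → ℝ) (n : ℕ) => (iteratedFDeriv ℝ n f 0 :
      ContinuousMultilinearMap ℝ (fun _ : Fin n => CellVars ϑ) ℝ) := continuous_induced_dom
  have h : ∀ v : Fin 2 → CellVars ϑ,
      Continuous fun f : CellVars ϑ → ℝ => iteratedFDeriv ℝ 2 f 0 v := fun v =>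
    (continuous_eval_const v).comp ((continuous_apply 2).comp hjet)
  exact (h _).add ((h _).const_mul μ)

theorem continuous_add_smul_lamMulSelf {f : CellVars ϑ → ℝ} (hf : SmoothNear f 0) :
    Continuous[inferInstance, jetTopology ϑ] fun e : ℝ => f + e • lamMulSelf ϑ := by
  let _ := jetTopology ϑ
  refine continuous_induced_rng.2 (continuous_pi fun n => ?_)
  simp only [Function.comp_def, iteratedFDeriv_add_smul_lamMulSelf hf]
  fun_prop

/-- Non-vanishing crossing speed is a generic condition. -/
theorem Generically.and_crossingSpeed_ne_zero [NeZero ϑ] {μ : ℝ} {P : (CellVars ϑ → ℝ) → Prop}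
    (h : Generically μ P) : Generically μ fun f => P f ∧ crossingSpeed μ f ≠ 0 := by
  obtain ⟨O, hO, hdense, hP⟩ := h
  let _ := jetTopology ϑ
  have hopen : IsOpen {f : CellVars ϑ → ℝ | crossingSpeed μ f ≠ 0} :=
    isOpen_ne.preimage (continuous_crossingSpeed μ)
  refine ⟨O ∩ {f | crossingSpeed μ f ≠ 0}, hO.inter hopen, ?_, fun f hf hB => ⟨hP f hf.1 hB, hf.2⟩⟩
  refine hdense.trans (closure_minimal ?_ isClosed_closure)
  rintro f ⟨hfO, hfB⟩
  have hfB' : HasBifurcationCondition μ f := hfB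
  have hf : SmoothNear f 0 := hfB'.smooth
  have hc : Tendsto (fun e : ℝ => f + e • lamMulSelf ϑ) (𝓝[≠] 0) (𝓝 f) := by
    have h1 := (continuous_add_smul_lamMulSelf hf).tendsto 0
    rw [zero_smul, add_zero] at h1
    exact h1.mono_left nhdsWithin_le_nhds
  refine mem_closure_of_tendsto hc ?_
  have hne : ∀ᶠ e : ℝ in 𝓝[≠] 0, e ≠ - crossingSpeed μ f := by
    by_cases h0 : - crossingSpeed μ f = 0
    · rw [h0]
      exact self_mem_nhdsWithin
    · exact nhdsWithin_le_nhds (isOpen_ne.mem_nhds (Ne.symm h0))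
  filter_upwards [hc.eventually (hO.mem_nhds hfO), hne] with e h1 h2
  refine ⟨⟨h1, ?_⟩, hfB'.add_smul_lamMulSelf e⟩
  rw [mem_ofPred_eq, crossingSpeed_add_smul_lamMulSelf μ hf]
  exact fun h3 => h2 (by linarith)

theorem Generically.mono [NeZero ϑ] {μ : ℝ} {P Q : (CellVars ϑ → ℝ) → Prop}
    (h : Generically μ P) (hPQ : ∀ f, HasBifurcationCondition μ f → P f → Q f) :
    Generically μ Q := by
  obtain ⟨O, hO, hdense, hP⟩ := h
  exact ⟨O, hO, hdense, fun f hf hB => hPQ f hB (hP f hf hB)⟩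

end Generic

/-! ### Polydiagonals and quotient networks -/

theorem exists_eq_comp_mk_of_mem_polydiagonal {C : Type*} {r : Setoid C} {x : C → ℝ}
    (hx : x ∈ polydiagonal r) : x = (x ∘ Quotient.out) ∘ Quotient.mk r :=
  funext fun c => hx c _ (Quotient.exact (Quotient.out_eq _).symm)

theorem comp_mk_mem_polydiagonal {C : Type*} (r : Setoid C) (y : Quotient r → ℝ) :
    y ∘ Quotient.mk r ∈ polydiagonal r :=
  fun _ _ h => congrArg y (Quotient.sound h)

namespace RegularNetwork

variable {C E : Type*} [Fintype C] [Finite E] {ϑ : ℕ} [NeZero ϑ]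

theorem jacobian_vectorField_comp_mk (N : RegularNetwork C E ϑ) {r : Setoid C}
    (hr : N.IsBalanced r) {μ : ℝ} {f : CellVars ϑ → ℝ} (hf : HasBifurcationCondition μ f)
    (y : Quotient r → ℝ) :
    jacobian (N.vectorField f) (y ∘ Quotient.mk r) =
      jacobian ((N.quotient r).vectorField f) y ∘ Quotient.mk r := by
  let L : (Quotient r → ℝ) →L[ℝ] (C → ℝ) :=
    ContinuousLinearMap.pi fun c => ContinuousLinearMap.proj (Quotient.mk r c)
  have hL : ∀ y, L y = y ∘ Quotient.mk r := fun y => rfl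
  have hd : ∀ {C' E' : Type _} [Fintype C'] [Finite E'] (N' : RegularNetwork C' E' ϑ),
      HasFDerivAt (fun x => N'.vectorField f (x, 0))
        (fderiv ℝ (fun x => N'.vectorField f (x, 0)) 0) 0 := fun N' =>
    (DifferentiableAt.comp (f := fun x => (x, (0 : ℝ))) 0
      (N'.smoothNear_vectorField hf.smooth).differentiableAt (by fun_prop)).hasFDerivAt
  have h1 := HasFDerivAt.comp (f := L) 0 (by rw [map_zero]; exact hd N) L.hasFDerivAt
  have h2 := L.hasFDerivAt.comp (0 : Quotient r → ℝ) (hd (N.quotient r))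
  have heq : (fun x => N.vectorField f (x, 0)) ∘ L =
      L ∘ fun y => (N.quotient r).vectorField f (y, 0) :=
    funext fun y => N.vectorField_comp_mk hr hf.symmetric y 0
  rw [heq] at h1
  exact DFunLike.congr_fun (h1.unique h2) y

/-- The part of the kernel in the polydiagonal is the kernel for the quotient network. -/
theorem finrank_ker_jacobian_quotient (N : RegularNetwork C E ϑ) {r : Setoid C}
    (hr : N.IsBalanced r) {μ : ℝ} {f : CellVars ϑ → ℝ} (hf : HasBifurcationCondition μ f) :
    Module.finrank ℝ (LinearMap.ker (jacobian ((N.quotient r).vectorField f))) =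
      Module.finrank ℝ ↥(LinearMap.ker (jacobian (N.vectorField f)) ⊓ polydiagonal r) := by
  let L : (Quotient r → ℝ) →ₗ[ℝ] (C → ℝ) := LinearMap.funLeft ℝ ℝ (Quotient.mk r)
  have hL : Function.Injective L :=
    LinearMap.funLeft_injective_of_surjective ℝ ℝ _ Quotient.mk_surjective
  have hmap : (LinearMap.ker (jacobian ((N.quotient r).vectorField f))).map L =
      LinearMap.ker (jacobian (N.vectorField f)) ⊓ polydiagonal r := by
    apply le_antisymm
    · rintro _ ⟨y, hy, rfl⟩
      refine ⟨?_, comp_mk_mem_polydiagonal r y⟩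
      have hy' : jacobian ((N.quotient r).vectorField f) y = 0 := hy
      have h := N.jacobian_vectorField_comp_mk hr hf y
      rw [hy'] at h
      exact h
    · rintro x ⟨hx, hxr⟩
      have hxe := exists_eq_comp_mk_of_mem_polydiagonal hxr
      refine ⟨x ∘ Quotient.out, ?_, hxe.symm⟩
      have hx' : jacobian (N.vectorField f) x = 0 := hx
      rw [hxe, N.jacobian_vectorField_comp_mk hr hf] at hx'
      exact hL hx'
  rw [← hmap]
  exact (Submodule.equivMapOfInjective L hL _).finrank_eq

/-- If `μ` is not an eigenvalue of the quotient by `r`, then all zeros of the vector field near the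
origin with synchrony `r` are trivial. -/
theorem eventually_eq_zero_of_mem_polydiagonal (N : RegularNetwork C E ϑ) {r : Setoid C}
    (hr : N.IsBalanced r) {μ : ℝ} {f : CellVars ϑ → ℝ} (hf : HasBifurcationCondition μ f)
    (hμ : ¬ (N.quotient r).IsEigenvalue μ) :
    ∀ᶠ p in 𝓝 (0 : (C → ℝ) × ℝ), p.1 ∈ polydiagonal r → N.vectorField f p = 0 → p.1 = 0 := by
  have h := eventually_eq_zero_of_orthogonal ((N.quotient r).smoothNear_vectorField hf.smooth)
    ((N.quotient r).vectorField_zero hf)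
  have hc : Continuous fun p : (C → ℝ) × ℝ => ((p.1 ∘ Quotient.out : Quotient r → ℝ), p.2) := by
    refine Continuous.prodMk (continuous_pi fun q => ?_) continuous_snd
    exact (continuous_apply _).comp continuous_fst
  filter_upwards [(hc.tendsto 0).eventually h] with p hp hpr hz
  have hpe := exists_eq_comp_mk_of_mem_polydiagonal hpr
  have h1 : (N.quotient r).vectorField f (p.1 ∘ Quotient.out, p.2) = 0 := by
    have h2 := N.vectorField_comp_mk hr hf.symmetric (p.1 ∘ Quotient.out) p.2
    rw [← hpe] at h2
    have h3 : (N.quotient r).vectorField f (p.1 ∘ Quotient.out, p.2) ∘ Quotient.mk r = 0 :=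
      h2.symm.trans hz
    funext q
    obtain ⟨c, rfl⟩ := Quotient.exists_rep q
    exact congrFun h3 c
  have h2 : (p.1 ∘ Quotient.out : Quotient r → ℝ) = 0 := by
    refine hp (fun x hx => ?_) (by rw [h1, dotProduct_zero])
    rw [(N.quotient r).jacobian_vectorField_injective hf hμ, Submodule.mem_bot] at hx
    rw [hx, zero_dotProduct]
  rw [hpe, h2]
  rfl

theorem hasDerivAt_fderiv_g (N : RegularNetwork C E ϑ) {μ : ℝ} {f : CellVars ϑ → ℝ}
    (hf : HasBifurcationCondition μ f) {m : ℕ} (R : LyapunovSchmidt (N.vectorField f) m)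
    (u : EuclideanSpace ℝ (Fin m)) :
    HasDerivAt (fun l => fderiv ℝ (fun y => R.g (y, l)) 0 u) (crossingSpeed μ f • u) 0 := by
  have hs : SmoothNear f 0 := hf.smooth
  have hσ : HasDerivAt (fun l : ℝ => fderiv ℝ f (0, 0, l) (1, 0, 0) +
      μ * fderiv ℝ f (0, 0, l) (0, Pi.single 0 1, 0)) (crossingSpeed μ f) 0 :=
    (hasDerivAt_fderiv_apply_lam hs _).add ((hasDerivAt_fderiv_apply_lam hs _).const_mul μ)
  refine R.hasDerivAt_fderiv_g (N.smoothNear_vectorField hs) (N.vectorField_zero hf) hσ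
    hf.critical ?_ u
  -- the `w_i` are orthogonal to the range of `f₁ (A - μ)`, so they are left eigenvectors of `A`
  have hA : ∀ i z, R.w i ⬝ᵥ N.adjacencyEnd z = μ * (R.w i ⬝ᵥ z) := by
    intro i z
    have h := R.w_orth i z
    rw [N.jacobian_vectorField hf, dotProduct_smul, smul_eq_zero_iff_right hf.coeff1_ne_zero,
      dotProduct_sub, dotProduct_smul, smul_eq_mul] at h
    linarith
  have ht : Tendsto (fun l : ℝ => ((0, 0, l) : CellVars ϑ)) (𝓝 0) (𝓝 0) :=
    Continuous.tendsto (f := fun l : ℝ => ((0, 0, l) : CellVars ϑ)) (by fun_prop) 0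
  filter_upwards [ht.eventually hs] with l hl i z
  rw [N.fderiv_vectorField hf.symmetric (hl.differentiableAt (by simp)), dotProduct_add,
    dotProduct_smul, dotProduct_smul, hA]
  simp only [smul_eq_mul]
  ring

end RegularNetwork

/-! ### Bifurcating branches -/

namespace LyapunovSchmidt

variable {C : Type*} [Fintype C] {F : (C → ℝ) × ℝ → C → ℝ} {m : ℕ}

theorem continuous_Q (R : LyapunovSchmidt F m) (k : ℕ) : Continuous (R.Q k) := by
  have h : Continuous fun u => iteratedFDeriv ℝ k (fun y => R.g (y, 0)) 0 fun _ => u :=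
    (iteratedFDeriv ℝ k (fun y => R.g (y, 0)) 0).cont.comp (continuous_pi fun _ => continuous_id)
  exact h.const_smul (k.factorial : ℝ)⁻¹

theorem Q_neg (R : LyapunovSchmidt F m) {k : ℕ} (hk : Even k) (u : EuclideanSpace ℝ (Fin m)) :
    R.Q k (-u) = R.Q k u := by
  have h := (iteratedFDeriv ℝ k (fun y => R.g (y, 0)) 0).map_smul_univ (fun _ => (-1 : ℝ))
    fun _ => u
  simp only [neg_smul, one_smul, Finset.prod_const, Finset.card_univ, Fintype.card_fin,
    hk.neg_one_pow] at h
  rw [Q, Q, h]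

theorem two_le_of_isOrder (R : LyapunovSchmidt F m) {k : ℕ} (hk : R.IsOrder k) (hk_even : Even k)
    (h0 : R.g 0 = 0) : 2 ≤ k := by
  rcases Nat.lt_or_ge k 2 with h | h
  · have hk0 : k = 0 := by
      obtain ⟨j, rfl⟩ := hk_even
      omega
    subst hk0
    refine absurd ?_ hk.1
    ext x : 1
    rw [iteratedFDeriv_zero_apply]
    exact h0
  · exact h

/-- In dimension two with even order, condition `H1` produces a curve of zeros of the reduced
function leaving the origin. -/
theorem exists_zero_curve_of_even {R : LyapunovSchmidt F 2} (hF : SmoothNear F 0)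
    (hF0 : ∀ l, F (0, l) = 0) {a : ℝ} (ha : a ≠ 0)
    (hg : ∀ u, HasDerivAt (fun l => fderiv ℝ (fun y => R.g (y, l)) 0 u) (a • u) 0) {k : ℕ}
    (hk : 2 ≤ k) (hord : R.IsOrder k) (hk_even : Even k) (hH1 : R.H1 a k) :
    ∃ (u : ℝ → EuclideanSpace ℝ (Fin 2)) (η : ℝ → ℝ),
      (∀ᶠ z in 𝓝 0, DifferentiableAt ℝ u z ∧ DifferentiableAt ℝ η z) ∧
      ∀ᶠ z in 𝓝 0, ‖u z‖ = 1 ∧ R.g (z • u z, z ^ (k - 1) * η z) = 0 := by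
  obtain ⟨u₀, hu₀, hQ⟩ := exists_tangential_zero_of_even (R.continuous_Q k) (R.Q_neg hk_even)
  have hz : R.hTilde a k u₀ = 0 := by
    rw [hTilde, h, etaTilde, div_mul_cancel₀ _ ha, neg_smul, ← hQ, neg_add_cancel]
  have hg0 : ∀ᶠ l in 𝓝 (0 : ℝ), R.g (0, l) = 0 := by
    filter_upwards [R.eventually_W_zero_eq_zero hF hF0] with l hl
    rw [g_eq, hl, map_zero, add_zero, hF0, map_zero]
  refine exists_zero_curve (R.smoothNear_g hF) hg0 hg hk (fun l hl => ?_) hu₀ hz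
    fun v s hv h0 => ?_
  · by_contra hne
    exact absurd (hord.2 hne) (by omega)
  · have hmem : v ∈ (Submodule.span ℝ {u₀})ᗮ :=
      Submodule.mem_orthogonal_singleton_iff_inner_right.2 hv
    have hinj := (hH1 u₀ hu₀ hz).1
    have h1 := @hinj (⟨v, hmem⟩, s) 0 (h0.trans (by
      change 0 = fderiv ℝ _ _ 0
      rw [map_zero]))
    have h2 := Prod.ext_iff.1 h1
    exact Prod.ext (congrArg Subtype.val h2.1) h2.2

end LyapunovSchmidt

theorem mainTheorem3 {C : Type*} {E : Type*} [Fintype C] [Finite E] {ϑ : ℕ} [NeZero ϑ]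
    (N : RegularNetwork C E ϑ) (r : Setoid C) (hr : N.IsBalanced r)
    (μ : ℝ) (hμ : N.IsSemisimpleEigenvalue μ) (hmax : N.IsMaximalColoring μ r)
    (k : ℕ) (hk : (N.quotient r).HasGenericOrder μ k) (hk_even : Even k) :
    Generically μ fun f : CellVars ϑ → ℝ =>
      (∀ᶠ x in 𝓝[≠] (0 : C → ℝ), N.vectorField f (x, 0) ≠ 0) →
      Module.finrank ℝ
        ↥(LinearMap.ker (jacobian (N.vectorField f)) ⊓ polydiagonal r) = 2 →
      (N.quotient r).ConditionH1 f μ k →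
      ∃ (δ : ℝ) (b : ℝ → (C → ℝ) × ℝ),
        N.IsBifurcationBranch f δ b ∧ N.HasExactSynchrony r δ b := by
  refine (Generically.and_crossingSpeed_ne_zero hk).mono ?_
  rintro f hB ⟨hord, ha⟩ hiso hdim ⟨m, R, hH1⟩
  have hm := R.eq_finrank
  rw [N.finrank_ker_jacobian_quotient hr hB, hdim] at hm
  subst hm
  have hF := (N.quotient r).smoothNear_vectorField hB.smooth
  have hF0 := (N.quotient r).vectorField_zero hB
  have hR := hord.2 2 R
  have hk2 : 2 ≤ k := R.two_le_of_isOrder hR hk_even (by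
    rw [R.g_eq]
    simp [R.W_zero, hF0])
  obtain ⟨u, η, hd, hu⟩ := R.exists_zero_curve_of_even hF hF0 ha
    ((N.quotient r).hasDerivAt_fderiv_g hB R) hk2 hR hk_even hH1
  have hk1 : k - 1 ≠ 0 := by omega
  -- the curve `p` of zeros of the reduced function, and the corresponding equilibria `b`
  let p : ℝ → EuclideanSpace ℝ (Fin 2) × ℝ := fun z => (z • u z, z ^ (k - 1) * η z)
  let X : ℝ → Quotient r → ℝ := fun z => R.embed (p z).1 + R.W (p z)
  let b : ℝ → (C → ℝ) × ℝ := fun z => (X z ∘ Quotient.mk r, (p z).2)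
  have hpd : ∀ᶠ z in 𝓝 0, DifferentiableAt ℝ p z := hd.mono fun z hz =>
    (differentiableAt_id.smul hz.1).prodMk ((differentiableAt_id.pow _).mul hz.2)
  have hp0 : p 0 = 0 := by simp [p, hk1]
  have hpt : Tendsto p (𝓝 0) (𝓝 0) := by
    have := hpd.self_of_nhds.continuousAt.tendsto
    rwa [hp0] at this
  have hbd : ∀ᶠ z in 𝓝 0, DifferentiableAt ℝ b z := by
    filter_upwards [hpd, hpt.eventually R.W_smooth] with z h1 h2
    have h3 : DifferentiableAt ℝ X z := (R.embed.differentiableAt.comp z h1.fst).add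
      ((h2.differentiableAt (by simp)).comp z h1)
    exact (differentiableAt_pi.2 fun c => differentiableAt_pi.1 h3 (Quotient.mk r c)).prodMk h1.snd
  have hb0 : b 0 = 0 := by
    have h1 : X 0 = 0 := by simp [X, hp0, R.W_zero]
    have h2 : b 0 = (X 0 ∘ Quotient.mk r, (p 0).2) := rfl
    rw [h2, h1, hp0]
    rfl
  have hbt : Tendsto b (𝓝 0) (𝓝 0) := by
    have := hbd.self_of_nhds.continuousAt.tendsto
    rwa [hb0] at this
  have hbe : ∀ᶠ z in 𝓝 0, N.vectorField f (b z) = 0 := by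
    filter_upwards [hu, hpt.eventually R.eventually_solution_of_g_eq_zero] with z h1 h2
    have h3 := N.vectorField_comp_mk hr hB.symmetric (X z) (p z).2
    rw [h2 h1.2] at h3
    exact h3
  have hbn : ∀ᶠ z in 𝓝 0, z ≠ 0 → (b z).1 ≠ 0 := by
    filter_upwards [hu, hpt.eventually R.eventually_embed_add_ne_zero] with z h1 h2 hz hb
    have h3 : (p z).1 ≠ 0 := by
      refine smul_ne_zero hz fun h0 => ?_
      rw [h0, norm_zero] at h1
      exact zero_ne_one h1.1
    refine h2 h3 (funext fun q => ?_)
    obtain ⟨c, rfl⟩ := Quotient.exists_rep q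
    exact congrFun hb c
  have hbx : Tendsto (fun z => (b z).1) (𝓝 0) (𝓝 0) := (continuous_fst.tendsto _).comp hbt
  have hbl : ∀ᶠ z in 𝓝 0, z ≠ 0 → (b z).2 ≠ 0 := by
    filter_upwards [hbx.eventually (eventually_nhdsWithin_iff.1 hiso), hbe,
      hbn] with z h1 h2 h3 hz hl
    refine h1 (h3 hz) ?_
    rw [← hl]
    exact h2
  obtain ⟨δ, hδ, hball⟩ := Metric.eventually_nhds_iff.1 (hbd.and (hbe.and (hbn.and hbl)))
  have hin : ∀ {z}, z ∈ Ico 0 δ → dist z 0 < δ := fun {z} hz => by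
    rw [Real.dist_0_eq_abs, abs_of_nonneg hz.1]
    exact hz.2
  have hin' : ∀ {z}, z ∈ Ioo 0 δ → dist z 0 < δ := fun {z} hz => hin ⟨hz.1.le, hz.2⟩
  refine ⟨δ, b, ⟨hδ, fun z hz => (hball (hin hz)).1.differentiableWithinAt, hb0,
    fun z hz => (hball (hin' hz)).2.2.2 hz.1.ne', fun z hz => (hball (hin' hz)).2.1,
    fun z hz => (hball (hin' hz)).2.2.1 hz.1.ne'⟩,
    fun z _ => comp_mk_mem_polydiagonal r (X z), fun r' hr' hlt hsync => ?_⟩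
  -- a branch with more synchrony would consist of trivial solutions
  have h1 := (hbt.eventually
    (N.eventually_eq_zero_of_mem_polydiagonal hr' hB (hmax r' hr' hlt))).filter_mono
    (nhdsWithin_le_nhds (s := Ioi 0))
  obtain ⟨z, hz, hzδ⟩ := (h1.and (Ioo_mem_nhdsGT hδ)).exists
  exact (hball (hin' hzδ)).2.2.1 hzδ.1.ne'
    (hz (hsync z ⟨hzδ.1.le, hzδ.2⟩) (hball (hin' hzδ)).2.1)
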